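/- Let $\mathcal E_1,\mathcal E_2$ be real Hilbert spaces and $\mathcal E=\mathcal E_1\times\mathcal E_2$ their product. Write $\sigma_S(\mu)=\sup_{x\in S}\langle\mu,x\rangle$, let $\iota_S$ be $0$ on $S$ and $+\infty$ elsewhere, let $\overline{\mathrm{co}}$ denote the closed convex hull, $f^*$ the Fenchel conjugate and $S^\ominus=\{x:\langle\mu,x\rangle\le0\ \forall\mu\in S\}$. Consider $\min_{x_1\in\mathcal E_1} f(x_1)+\sigma_Q(Ax_1-b)+\iota_K(x_1)$, with value $V$, and assume: $f:\mathcal E_1\to\mathbb R$ is convex and differentiable with $\beta$-Lipschitz gradient, $\beta>0$; $Q=Q_1+Q_2\subset\mathcal E_2$ is nonempty, $Q_1$ is a bounded closed convex set and $Q_2$ a closed convex cone; $K\subset\mathcal E_1$ is nonempty, closed and convex; $A:\mathcal E_1\to\mathcal E_2$ is bounded and linear; $b\in\mathcal E_2$; $K^{-1}\subset K$ is compact and $-b\in\operatorname{int}\big(Q_2^\ominus-A\,\overline{\mathrm{co}}\,K^{-1}\big)$. A set is called simple if it is the union of $K^{-1}$ and a finite set. Put $E=-\{x\in\mathcal E: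 x_1\in K,\ x_2=Ax_1\}$ and $$P(x_1)=f(x_1)+\sigma_Q(Ax_1-b),\qquad D(\mu)=f^*(\mu_1)+\iota_Q(\mu_2)+\langle\mu_2,b\rangle+\sigma_E(\mu).$$ The Dualized Level-Set method takes $\lambda\in(0,1)$, $\mu^0\in\mathcal E$ with $\mu^0_2\in Q$ and $\sigma_{-K}(\mu_1^0+A^*\mu_2^0)<+\infty$, and $w_1^0\in\partial f^*(\mu_1^0)$. It sets $\bar h^{-1}=\bar\Delta=+\infty$, $\hat\mu^{-1}=\mu^0$, and for $t=0,1,2,\dots$ it performs the following steps. 1. Oracle: choose $v_1^t\in-\operatorname{argmin}_{v\in K}\langle\mu_1^t+A^*\mu_2^t,v\rangle$; put $\tilde K^t=\overline{\mathrm{co}}(K^{t-1}\cup\{-v_1^t\})$. 2. Dual update: $\bar h^t=\min\{\bar h^{t-1},\ \langle\mu_2^t,b\rangle+\langle\mu_1^t,w_1^t\rangle+\langle\mu_1^t+A^*\mu_2^t,v_1^t\rangle-f(w_1^t)\}$; $\hat\mu^t=\mu^t$ if $\bar h^t<\bar h^{t-1}$, otherwise $\hat\mu^t=\hat\mu^{t-1}$.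 3. Primal update: $\hat x_1^t\in\operatorname{argmin}_{\tilde K^t}P$, $\underline h^t=-P(\hat x_1^t)$, $\Delta^t=\bar h^t-\underline h^t$, $\ell^t=\lambda\bar h^t+(1-\lambda)\underline h^t$. 4. Pruning: if $\Delta^t<(1-\lambda)\bar\Delta$, choose a simple $K^t\subset\tilde K^t$ with $\hat x_1^t\in\overline{\mathrm{co}}\,K^t$ and reset $\bar\Delta=\Delta^t$; otherwise $K^t=K^{t-1}\cup\{-v_1^t\}$. 5. Dual candidate: choose a minimizer $m^t$, over all nonpositive finite Borel measures $m$ on $K^t$, of $$(1-m(K^t))\,f\Big(\frac{w_1^t-\mathfrak Em}{1-m(K^t)}\Big)+\tfrac12\big(\|\tilde\mu_2\|^2-\operatorname{dist}(\tilde\mu_2,Q)^2\big)-\ell^t m(K^t),$$ where $\mathfrak Em=\int v\,dm(v)$ and $\tilde\mu_2=\mu_2^t+m(K^t)b-A\mathfrak Em$. Then $w_1^{t+1}=\frac{w_1^t-\mathfrak Em^t}{1-m^t(K^t)}$, $\mu_1^{t+1}=\nabla f(w_1^{t+1})$ and $\mu_2^{t+1}=\operatorname{proj}_Q\big(\mu_2^t+m^t(K^t)b-A\mathfrak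 Em^t\big)$. Consider an execution for which $(v_1^t)_{t\in\mathbb N}$ is bounded. Then $\Delta^t$ is the primal-dual gap, $\Delta^t=P(\hat x_1^t)+\iota_K(\hat x_1^t)+D(\hat\mu^t)$ for all $t$. For every $t$, exactly one solution $\hat x^t\in\mathcal E$ of the problem of minimizing $f(x_1)+\sigma_Q(x_2-b)$ over $\overline{\mathrm{co}}\big(\{x:x_1\in K^{t-1},x_2=Ax_1\}\cup\{-(v_1^t,Av_1^t)\}\big)$ has first component $\hat x_1^t$, and it satisfies $\hat x_2^t=A\hat x_1^t$. Moreover there is a constant $C>0$ such that, for all $t\ge1$, $$0\le\Delta^t\le\frac C{\sqrt t},\qquad 0\le f(\hat x_1^t)+\sigma_Q(A\hat x_1^t-b)-V\le\frac C{\sqrt t},$$ $$0\le f^*(\hat\mu_1^t)+\iota_Q(\hat\mu_2^t)+\langle\hat\mu_2^t,b\rangle+\sigma_E(\hat\mu^t)+V\le\frac C{\sqrt t}.$$ -/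

import Mathlib

open Set MeasureTheory
open scoped Pointwise InnerProductSpace NNReal Topology

noncomputable section

namespace DLS

/-! ### Convex analysis with values in the extended reals -/

section Convex

variable {H : Type*} [NormedAddCommGroup H] [InnerProductSpace ℝ H]

/-- The characteristic function `ι_S` of a set: `0` on `S`, `+∞` elsewhere. -/
def indic {α : Type*} (S : Set α) (x : α) : EReal :=
  open Classical in if x ∈ S then 0 else ⊤

/-- The support function `σ_S(μ) = sup_{x ∈ S} ⟨μ, x⟩`. -/
def supp (S : Set H) (μ : H) : EReal :=
  ⨆ x ∈ S, ((⟪μ, x⟫_ℝ : ℝ) : EReal)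

/-- The Legendre-Fenchel conjugate `f^*(μ) = sup_x ⟨μ, x⟩ - f(x)` of a real-valued function. -/
def conj (f : H → ℝ) (μ : H) : EReal :=
  ⨆ x : H, ((⟪μ, x⟫_ℝ - f x : ℝ) : EReal)

/-- The subdifferential of a function with values in the extended reals. -/
def subdiff (g : H → EReal) (μ : H) : Set H :=
  {w | ∀ ν : H, g μ + ((⟪w, ν - μ⟫_ℝ : ℝ) : EReal) ≤ g ν}

/-- The closed convex hull. -/
def cconv (S : Set H) : Set H := closure (convexHull ℝ S)

/-- The polar cone `S^⊖ = {x | ∀ μ ∈ S, ⟨μ, x⟩ ≤ 0}`. -/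
def polar (S : Set H) : Set H := {x | ∀ μ ∈ S, ⟪μ, x⟫_ℝ ≤ 0}

/-- The perspective function of a real-valued function `f`:
`s f(x / s)` if `s > 0`, `sup_y f(y + x) - f(y)` if `s = 0`, and `+∞` if `s < 0`. -/
def persp (f : H → ℝ) (x : H) (s : ℝ) : EReal :=
  if 0 < s then ((s * f (s⁻¹ • x) : ℝ) : EReal)
  else if s = 0 then ⨆ y : H, ((f (y + x) - f y : ℝ) : EReal)
  else ⊤

end Convex

/-- `x` is a solution to the problem of minimizing `g` over `S`. -/
def IsSolution {α β : Type*} [Preorder β] (g : α → β) (S : Set α) (x : α) : Prop :=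
  x ∈ S ∧ ∀ y ∈ S, g x ≤ g y

section Problem

variable {E₁ E₂ : Type*}
  [NormedAddCommGroup E₁] [InnerProductSpace ℝ E₁]
  [NormedAddCommGroup E₂] [InnerProductSpace ℝ E₂]

/-- The cost `f(x₁) + σ_Q(A x₁ - b)`. -/
def cost (f : E₁ → ℝ) (A : E₁ →L[ℝ] E₂) (b : E₂) (Q : Set E₂) (x₁ : E₁) : EReal :=
  (f x₁ : EReal) + supp Q (A x₁ - b)

/-- The value `V` of the primal problem: minimize `f(x₁) + σ_Q(A x₁ - b) + ι_K(x₁)`. -/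
def value (f : E₁ → ℝ) (A : E₁ →L[ℝ] E₂) (b : E₂) (Q : Set E₂) (K : Set E₁) : EReal :=
  ⨅ x₁ : E₁, cost f A b Q x₁ + indic K x₁

/-- The cost `f(x₁) + σ_Q(x₂ - b)` on the product space. -/
def liftedCost (f : E₁ → ℝ) (b : E₂) (Q : Set E₂) (x : WithLp 2 (E₁ × E₂)) : EReal :=
  (f x.fst : EReal) + supp Q (x.snd - b)

/-- The set `{x | x₁ ∈ S, x₂ = A x₁}` in the product Hilbert space. -/
def graphOver (A : E₁ →L[ℝ] E₂) (S : Set E₁) : Set (WithLp 2 (E₁ × E₂)) :=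
  {x | x.fst ∈ S ∧ x.snd = A x.fst}

/-- The dual cost `f^*(μ₁) + ι_Q(μ₂) + ⟨μ₂, b⟩ + σ_E(μ)`, where
`E = -{x | x₁ ∈ K, x₂ = A x₁}`. -/
def dualCost (f : E₁ → ℝ) (A : E₁ →L[ℝ] E₂) (b : E₂) (Q : Set E₂) (K : Set E₁)
    (μ : WithLp 2 (E₁ × E₂)) : EReal :=
  conj f μ.fst + indic Q μ.snd + ((⟪μ.snd, b⟫_ℝ : ℝ) : EReal) + supp (-graphOver A K) μ

/-- The sets of the form `K⁻¹ ∪ S` with `S` finite. -/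
def IsSimpleSet (Kinit K' : Set E₁) : Prop :=
  ∃ S : Set E₁, S.Finite ∧ K' = Kinit ∪ S

/-! ### The projection subproblem

An element `m` of `-M₊(S)` is encoded by the nonnegative finite Borel measure `n = -m`. It is seen
as a measure on `E₁` that vanishes outside `S`. Thus `m(S) = -(mass n)` and the vector `𝔈 m`,
characterized by `⟨μ, 𝔈 m⟩ = ∫_S ⟨μ, v⟩ dm(v)` for all `μ`, is `-(mean n)`. -/

section Measure

variable [MeasurableSpace E₁]

/-- The nonnegative finite measures on `S`. -/
def posMeasures (S : Set E₁) : Set (Measure E₁) := {n | IsFiniteMeasure n ∧ n Sᶜ = 0}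

/-- The total mass of a finite measure. -/
def mass (n : Measure E₁) : ℝ := n.real univ

/-- The vector `∫ v dn(v)`. -/
def mean (n : Measure E₁) : E₁ := ∫ v, v ∂n

/-- The vector `μ̃₂ = -A 𝔈 m + m(S) b + μ₂`, for `m = -n`. -/
def shifted (A : E₁ →L[ℝ] E₂) (b : E₂) (μ₂ : E₂) (n : Measure E₁) : E₂ :=
  A (mean n) - mass n • b + μ₂

/-- The cost of the projection subproblem,
`f̃(-𝔈 m + w, 1 - m(S)) + (‖μ̃₂‖² - dist(μ̃₂, Q)²) / 2 - ℓ m(S)`, for `m = -n`. -/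
def projCost (f : E₁ → ℝ) (A : E₁ →L[ℝ] E₂) (b : E₂) (Q : Set E₂)
    (w : E₁) (μ₂ : E₂) (ℓ : EReal) (n : Measure E₁) : EReal :=
  persp f (mean n + w) (1 + mass n)
    + (((‖shifted A b μ₂ n‖ ^ 2 - Metric.infDist (shifted A b μ₂ n) Q ^ 2) / 2 : ℝ) : EReal)
    + ℓ * ((mass n : ℝ) : EReal)

end Measure

/-! ### The Dualized Level-Set method -/

/-- The quantities produced along the iterations `t = 0, 1, 2, …`. A field whose name ends in
`Before` holds the value available at the *beginning* of iteration `t`, i.e. the one that carries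
the superscript `t - 1`. -/
structure Trace (E₁ E₂ : Type*) [MeasurableSpace E₁] where
  /-- the dual candidate `μ^t` -/
  μ : ℕ → WithLp 2 (E₁ × E₂)
  /-- the vector `w₁^t` -/
  w : ℕ → E₁
  /-- the output `v₁^t` of the oracle -/
  v : ℕ → E₁
  /-- `h̄^{t-1}` -/
  hbarBefore : ℕ → EReal
  /-- `μ̂^{t-1}` -/
  μhatBefore : ℕ → WithLp 2 (E₁ × E₂)
  /-- the primal iterate `x̂₁^t` -/
  xhat : ℕ → E₁
  /-- the value of `Δ̄` at the beginning of iteration `t` -/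
  ΔbarBefore : ℕ → EReal
  /-- `K^{t-1}` -/
  KBefore : ℕ → Set E₁
  /-- the measure `-m^t` -/
  n : ℕ → Measure E₁

namespace Trace

variable [MeasurableSpace E₁]

/-- `h̄^t` -/
def hbar (T : Trace E₁ E₂) (t : ℕ) : EReal := T.hbarBefore (t + 1)

/-- `μ̂^t` -/
def μhat (T : Trace E₁ E₂) (t : ℕ) : WithLp 2 (E₁ × E₂) := T.μhatBefore (t + 1)

/-- `K^t` -/
def Kcut (T : Trace E₁ E₂) (t : ℕ) : Set E₁ := T.KBefore (t + 1)

/-- `K̃^t`, the closed convex hull of `K^{t-1} ∪ {-v₁^t}` -/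
def Ktilde (T : Trace E₁ E₂) (t : ℕ) : Set E₁ := cconv (T.KBefore t ∪ {-T.v t})

/-- `Ẽ^t`, the closed convex hull of `E^{t-1} ∪ {v^t}`, where
`E^{t-1} = {x | x₁ ∈ -K^{t-1}, x₂ = A x₁}` and `v^t = (v₁^t, A v₁^t)` -/
def Etilde (T : Trace E₁ E₂) (A : E₁ →L[ℝ] E₂) (t : ℕ) : Set (WithLp 2 (E₁ × E₂)) :=
  cconv (graphOver A (-T.KBefore t) ∪ {WithLp.toLp 2 (T.v t, A (T.v t))})

/-- the lower bound `-f(x̂₁^t) - σ_Q(A x̂₁^t - b)` -/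
def hunder (T : Trace E₁ E₂) (f : E₁ → ℝ) (A : E₁ →L[ℝ] E₂) (b : E₂) (Q : Set E₂) (t : ℕ) :
    EReal :=
  -cost f A b Q (T.xhat t)

/-- the gap `Δ^t` -/
def Δ (T : Trace E₁ E₂) (f : E₁ → ℝ) (A : E₁ →L[ℝ] E₂) (b : E₂) (Q : Set E₂) (t : ℕ) : EReal :=
  T.hbar t - T.hunder f A b Q t

/-- the level `ℓ^t` -/
def level (T : Trace E₁ E₂) (f : E₁ → ℝ) (A : E₁ →L[ℝ] E₂) (b : E₂) (Q : Set E₂) (lam : ℝ)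
    (t : ℕ) : EReal :=
  (lam : EReal) * T.hbar t + ((1 - lam : ℝ) : EReal) * T.hunder f A b Q t

end Trace

/-- `T` is an execution of the Dualized Level-Set method with parameter `lam`. -/
structure IsRun [MeasurableSpace E₁] [CompleteSpace E₁] [CompleteSpace E₂]
    (f : E₁ → ℝ) (A : E₁ →L[ℝ] E₂) (b : E₂) (Q : Set E₂)
    (K Kinit : Set E₁) (lam : ℝ) (T : Trace E₁ E₂) : Prop where
  -- Requirements and initialization (`w₁⁰ ∈ ∂f^*(μ₁⁰)` contains `μ₁⁰ ∈ dom ∂f^*`)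
  init_w : T.w 0 ∈ subdiff (conj f) (T.μ 0).fst
  init_μ₂ : (T.μ 0).snd ∈ Q
  init_dom : ∃ r : ℝ, supp (-K) ((T.μ 0).fst + A.adjoint (T.μ 0).snd) = (r : EReal)
  init_hbar : T.hbarBefore 0 = ⊤
  init_μhat : T.μhatBefore 0 = T.μ 0
  init_Δbar : T.ΔbarBefore 0 = ⊤
  init_K : T.KBefore 0 = Kinit
  -- Oracle
  oracle : ∀ t, IsSolution (fun v₁ => ⟪(T.μ t).fst + A.adjoint (T.μ t).snd, v₁⟫_ℝ) K (-T.v t)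
  -- Dual update
  hbar_eq : ∀ t, T.hbar t = min (T.hbarBefore t)
    ((⟪(T.μ t).snd, b⟫_ℝ + ⟪(T.μ t).fst, T.w t⟫_ℝ
      + ⟪(T.μ t).fst + A.adjoint (T.μ t).snd, T.v t⟫_ℝ - f (T.w t) : ℝ) : EReal)
  μhat_new : ∀ t, T.hbar t < T.hbarBefore t → T.μhat t = T.μ t
  μhat_old : ∀ t, ¬ T.hbar t < T.hbarBefore t → T.μhat t = T.μhatBefore t
  -- Primal update
  xhat_sol : ∀ t, IsSolution (cost f A b Q) (T.Ktilde t) (T.xhat t)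
  -- Pruning
  prune : ∀ t, T.Δ f A b Q t < ((1 - lam : ℝ) : EReal) * T.ΔbarBefore t →
    T.Kcut t ⊆ T.Ktilde t ∧ IsSimpleSet Kinit (T.Kcut t) ∧ T.xhat t ∈ cconv (T.Kcut t) ∧
      T.ΔbarBefore (t + 1) = T.Δ f A b Q t
  no_prune : ∀ t, ¬ T.Δ f A b Q t < ((1 - lam : ℝ) : EReal) * T.ΔbarBefore t →
    T.Kcut t = T.KBefore t ∪ {-T.v t} ∧ T.ΔbarBefore (t + 1) = T.ΔbarBefore t
  -- Dual candidate
  n_sol : ∀ t, IsSolution (projCost f A b Q (T.w t) (T.μ t).snd (T.level f A b Q lam t))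
    (posMeasures (T.Kcut t)) (T.n t)
  w_next : ∀ t, T.w (t + 1) = (1 + mass (T.n t))⁻¹ • (T.w t + mean (T.n t))
  μ₁_next : ∀ t, (T.μ (t + 1)).fst = gradient f (T.w (t + 1))
  μ₂_next : ∀ t, IsSolution (fun q => ‖shifted A b (T.μ t).snd (T.n t) - q‖) Q (T.μ (t + 1)).snd

end Problem

end DLS

end

/-! A point `w` of the primal space encodes the dual point `∇f(w)`, and the dual cost at
`(∇f(w), q)` is the supremum over `k ∈ K` of expressions `cut (w, q) k` that are affine in `k`. The
minimality of `m^t`, tested against convex combinations of measures, says that all the cuts over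
`K^t` are at most `ℓ^t` at the next dual point and that those charged by `m^t` are tight. Hence the
step is a projection for the Bregman divergence of `f^*` plus half the squared distance: it
decreases the divergence to every dual point that satisfies the cuts at level `ℓ^t` by at least the
divergence travelled.

During a phase without pruning the sets `K^t` increase. By minimax duality over the compact set
`K̃^t`, for the last index `t` of the phase, some dual points satisfy all the cuts over `K̃^t` at a
level arbitrarily close to `-P(x̂₁^t)`, hence all the constraints of the phase. They stay bounded by
the qualification condition, so the sum of the divergences travelled during a phase is bounded. On
the other hand, the cut of the oracle drops from at least `h̄^t` to at most `ℓ^t` within one step,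
and since `∇f` is Lipschitz this costs a divergence of order `(Δ^t)²`. So `(t - s) Δ²` is bounded
over a phase, and since a pruning multiplies the reference gap `Δ̄` by at most `1 - λ`, the phases
add up as a geometric series. -/

noncomputable section

namespace DLS

/-! ### Convex functions with Lipschitz gradient -/

section Smooth

variable {H : Type*} [NormedAddCommGroup H] [InnerProductSpace ℝ H]

theorem nonneg_of_hasDerivAt_of_forall_le {φ : ℝ → ℝ} {d : ℝ} (hφ : HasDerivAt φ d 0)
    (hmin : ∀ ε ∈ Ioc (0 : ℝ) 1, φ 0 ≤ φ ε) : 0 ≤ d := by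
  refine ge_of_tendsto hφ.tendsto_slope_zero_right ?_
  filter_upwards [Ioc_mem_nhdsGT one_pos] with ε hε
  rw [zero_add]
  exact mul_nonneg (inv_nonneg.2 hε.1.le) (sub_nonneg.2 (hmin ε hε))

theorem norm_sub_sq_three_point (x y z : H) :
    ‖x - y‖ ^ 2 + ‖z - x‖ ^ 2 - ‖z - y‖ ^ 2 = 2 * ⟪z - x, y - x⟫_ℝ := by
  have h : z - y = (z - x) - (y - x) := by abel
  rw [h, norm_sub_rev x y, norm_sub_sq_real (z - x)]
  ring

variable [CompleteSpace H] {f : H → ℝ} {β : ℝ≥0}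

theorem hasDerivAt_comp_add_smul {x d : H} {s : ℝ} (hf : DifferentiableAt ℝ f (x + s • d)) :
    HasDerivAt (fun r : ℝ => f (x + r • d)) ⟪gradient f (x + s • d), d⟫_ℝ s := by
  have hline : HasDerivAt (fun r : ℝ => x + r • d) d s := by
    simpa using ((hasDerivAt_id s).smul_const d).const_add x
  exact (hf.hasFDerivAt.comp_hasDerivAt s hline).congr_deriv (inner_gradient_left ..).symm

theorem inner_gradient_le_sub (hf : ConvexOn ℝ univ f) {x : H} (hx : DifferentiableAt ℝ f x)
    (y : H) : ⟪gradient f x, y - x⟫_ℝ ≤ f y - f x := by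
  have hderiv : HasDerivAt (fun r : ℝ => r * (f y - f x) - f (x + r • (y - x)))
      (f y - f x - ⟪gradient f x, y - x⟫_ℝ) 0 := by
    have hline := hasDerivAt_comp_add_smul (f := f) (x := x) (d := y - x) (s := 0) (by simpa)
    exact (((hasDerivAt_id (0 : ℝ)).mul_const (f y - f x)).sub hline).congr_deriv (by simp)
  refine sub_nonneg.1 (nonneg_of_hasDerivAt_of_forall_le hderiv fun ε hε => ?_)
  have hconv := hf.2 (mem_univ x) (mem_univ y) (sub_nonneg.2 hε.2) hε.1.le (sub_add_cancel 1 ε)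
  have hpt : (1 - ε) • x + ε • y = x + ε • (y - x) := by module
  rw [hpt, smul_eq_mul, smul_eq_mul] at hconv
  simp only [zero_mul, zero_smul, add_zero]
  linarith

theorem le_add_inner_gradient_add_sq (hf : Differentiable ℝ f) (hβ : LipschitzWith β (gradient f))
    (x y : H) : f y ≤ f x + ⟪gradient f x, y - x⟫_ℝ + β / 2 * ‖y - x‖ ^ 2 := by
  set d := y - x
  let φ : ℝ → ℝ := fun r => f (x + r • d) - r * ⟪gradient f x, d⟫_ℝ - β / 2 * ‖d‖ ^ 2 * r ^ 2
  have hderiv (r : ℝ) : HasDerivAt φ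
      (⟪gradient f (x + r • d) - gradient f x, d⟫_ℝ - β * ‖d‖ ^ 2 * r) r := by
    refine (((hasDerivAt_comp_add_smul (hf (x + r • d))).sub
      ((hasDerivAt_id r).mul_const ⟪gradient f x, d⟫_ℝ)).sub
      (((hasDerivAt_id r).pow 2).const_mul (β / 2 * ‖d‖ ^ 2))).congr_deriv ?_
    rw [inner_sub_left]
    simp only [id_eq, Nat.cast_ofNat]
    ring
  have hanti : AntitoneOn φ (Icc 0 1) := by
    refine antitoneOn_of_hasDerivWithinAt_nonpos (convex_Icc 0 1)
      (fun r _ => (hderiv r).continuousAt.continuousWithinAt)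
      (fun r _ => (hderiv r).hasDerivWithinAt) fun r hr => ?_
    have hr0 : 0 ≤ r := (interior_subset hr).1
    have hlip : ‖gradient f (x + r • d) - gradient f x‖ ≤ β * (r * ‖d‖) := by
      simpa [norm_smul, abs_of_nonneg hr0] using hβ.norm_sub_le (x + r • d) x
    have hcs := real_inner_le_norm (gradient f (x + r • d) - gradient f x) d
    nlinarith [norm_nonneg d]
  have hle := hanti (left_mem_Icc.2 zero_le_one) (right_mem_Icc.2 zero_le_one) zero_le_one
  have hy : x + d = y := add_sub_cancel x y
  simp only [φ, zero_smul, one_smul, add_zero, hy] at hle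
  linarith

/-- The Bregman divergence of a differentiable function. -/
def bregman (f : H → ℝ) (w y : H) : ℝ := f w - f y - ⟪gradient f y, w - y⟫_ℝ

theorem bregman_nonneg (hf : ConvexOn ℝ univ f) {y : H} (hy : DifferentiableAt ℝ f y) (w : H) :
    0 ≤ bregman f w y :=
  sub_nonneg.2 (inner_gradient_le_sub hf hy w)

theorem bregman_le (hf : Differentiable ℝ f) (hβ : LipschitzWith β (gradient f)) (w y : H) :
    bregman f w y ≤ β / 2 * ‖w - y‖ ^ 2 := by
  have := le_add_inner_gradient_add_sq hf hβ y w
  rw [bregman]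
  linarith

theorem bregman_three_point (f : H → ℝ) (w w' y : H) :
    bregman f w' y + bregman f w w' - bregman f w y =
      ⟪gradient f y - gradient f w', w - w'⟫_ℝ := by
  simp only [bregman, inner_sub_left, inner_sub_right]
  ring

/-- The bound comes from comparing the minimum of `bregman f · y` with its value after a gradient
step of length `1 / β` from `w`. -/
theorem norm_gradient_sub_sq_le_bregman (hconv : ConvexOn ℝ univ f) (hf : Differentiable ℝ f)
    (hβ : LipschitzWith β (gradient f)) (w y : H) :
    ‖gradient f w - gradient f y‖ ^ 2 ≤ 2 * β * bregman f w y := by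
  set g := gradient f w - gradient f y with hg
  rcases eq_or_ne (β : ℝ) 0 with hβ0 | hβ0
  · have hlip := hβ.norm_sub_le w y
    rw [hβ0, zero_mul, ← hg] at hlip
    simp [le_antisymm hlip (norm_nonneg g), hβ0]
  set z := w - (β : ℝ)⁻¹ • g with hz
  have hnonneg : 0 ≤ bregman f z y := bregman_nonneg hconv (hf y) z
  have hstep : bregman f z w ≤ (β : ℝ)⁻¹ / 2 * ‖g‖ ^ 2 := by
    refine (bregman_le hf hβ z w).trans_eq ?_
    rw [hz, sub_sub_cancel_left, norm_neg, norm_smul,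
      Real.norm_of_nonneg (inv_nonneg.2 β.coe_nonneg)]
    field_simp
  have hthree : bregman f w y + bregman f z w - bregman f z y = (β : ℝ)⁻¹ * ‖g‖ ^ 2 := by
    rw [bregman_three_point, hz, sub_sub_cancel_left, inner_neg_right, ← inner_neg_left, neg_sub,
      ← hg, real_inner_smul_right, real_inner_self_eq_norm_sq]
  have hle : (β : ℝ)⁻¹ * ‖g‖ ^ 2 ≤ 2 * bregman f w y := by linarith
  calc ‖g‖ ^ 2 = β * ((β : ℝ)⁻¹ * ‖g‖ ^ 2) := (mul_inv_cancel_left₀ hβ0 _).symm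
    _ ≤ β * (2 * bregman f w y) := by gcongr
    _ = 2 * β * bregman f w y := by ring

theorem conj_gradient (hf : ConvexOn ℝ univ f) {w : H} (hw : DifferentiableAt ℝ f w) :
    conj f (gradient f w) = ((⟪gradient f w, w⟫_ℝ - f w : ℝ) : EReal) := by
  refine le_antisymm (iSup_le fun x => EReal.coe_le_coe_iff.2 ?_) (le_iSup_of_le w le_rfl)
  have := inner_gradient_le_sub hf hw x
  rw [inner_sub_right] at this
  linarith

theorem eq_gradient_of_mem_subdiff_conj (hf : ConvexOn ℝ univ f) {μ w : H}
    (hw : DifferentiableAt ℝ f w) (h : w ∈ subdiff (conj f) μ) : μ = gradient f w := by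
  have hconj : conj f μ + ((⟪w, gradient f w - μ⟫_ℝ : ℝ) : EReal) ≤
      ((⟪gradient f w, w⟫_ℝ - f w : ℝ) : EReal) := conj_gradient hf hw ▸ h (gradient f w)
  have hmax (x : H) : ⟪μ, x⟫_ℝ - f x ≤ ⟪μ, w⟫_ℝ - f w := by
    have hle := (add_le_add_left (le_iSup (fun x => ((⟪μ, x⟫_ℝ - f x : ℝ) : EReal)) x)
      ((⟪w, gradient f w - μ⟫_ℝ : ℝ) : EReal)).trans hconj
    rw [← EReal.coe_add, EReal.coe_le_coe_iff, inner_sub_right, real_inner_comm (gradient f w) w,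
      real_inner_comm μ w] at hle
    linarith
  have hderiv := ((innerSL ℝ μ).hasFDerivAt (x := w)).sub hw.hasFDerivAt
  have hzero := IsLocalMax.hasFDerivAt_eq_zero
    (Filter.Eventually.of_forall hmax : IsLocalMax (fun x => ⟪μ, x⟫_ℝ - f x) w) hderiv
  refine ext_inner_right ℝ fun v => ?_
  have hv := DFunLike.congr_fun hzero v
  simpa [sub_eq_zero, inner_gradient_left] using hv

end Smooth

/-! ### Projections onto convex sets -/

section Projection

variable {H : Type*} [NormedAddCommGroup H] {Q : Set H} {z p : H}

theorem IsSolution.infDist_eq (hp : IsSolution (fun q => ‖z - q‖) Q p) :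
    Metric.infDist z Q = ‖z - p‖ := by
  refine le_antisymm (by simpa [dist_eq_norm] using Metric.infDist_le_dist_of_mem (x := z) hp.1) ?_
  simpa [Metric.le_infDist ⟨p, hp.1⟩, dist_eq_norm] using hp.2

variable [InnerProductSpace ℝ H]

theorem IsSolution.inner_sub_le_zero (hQ : Convex ℝ Q) (hp : IsSolution (fun q => ‖z - q‖) Q p) :
    ∀ q ∈ Q, ⟪z - p, q - p⟫_ℝ ≤ 0 := by
  rw [← norm_eq_iInf_iff_real_inner_le_zero hQ hp.1]
  have : Nonempty Q := ⟨⟨p, hp.1⟩⟩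
  exact le_antisymm (le_ciInf fun q => hp.2 q q.2)
    (ciInf_le (f := fun q : Q => ‖z - q‖) ⟨0, forall_mem_range.2 fun _ => norm_nonneg _⟩ ⟨p, hp.1⟩)

/-- The function `(‖z‖² - dist(z, Q)²) / 2` is smooth, and its gradient is the projection. -/
theorem IsSolution.norm_sq_sub_infDist_sq_le (hQ : Convex ℝ Q)
    (hp : IsSolution (fun q => ‖z - q‖) Q p) (d : H) :
    (‖z + d‖ ^ 2 - Metric.infDist (z + d) Q ^ 2) / 2 ≤
      (‖z‖ ^ 2 - Metric.infDist z Q ^ 2) / 2 + (⟪p, d⟫_ℝ + ‖d‖ ^ 2 / 2) := by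
  suffices h : ‖z + d‖ ^ 2 - (‖z‖ ^ 2 - ‖z - p‖ ^ 2 + 2 * ⟪p, d⟫_ℝ + ‖d‖ ^ 2) ≤
      Metric.infDist (z + d) Q ^ 2 by
    rw [hp.infDist_eq]
    linarith
  rw [← Real.sqrt_le_left Metric.infDist_nonneg, Metric.le_infDist ⟨p, hp.1⟩]
  intro q hq
  rw [Real.sqrt_le_left dist_nonneg, dist_eq_norm]
  have hproj : ⟪z - p, q - p⟫_ℝ ≤ 0 := hp.inner_sub_le_zero hQ q hq
  have hsq : ‖z + d - q‖ ^ 2 -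
      (‖z + d‖ ^ 2 - (‖z‖ ^ 2 - ‖z - p‖ ^ 2 + 2 * ⟪p, d⟫_ℝ + ‖d‖ ^ 2)) =
      ‖d - (q - p)‖ ^ 2 - 2 * ⟪z - p, q - p⟫_ℝ := by
    simp only [norm_sub_sq_real, inner_sub_left, inner_sub_right, inner_add_left,
      real_inner_self_eq_norm_sq, real_inner_comm d p, real_inner_comm q p]
    ring
  linarith [sq_nonneg ‖d - (q - p)‖]

end Projection

/-! ### Cuts of the dual cost -/

section Cut

variable {E₁ E₂ : Type*} [NormedAddCommGroup E₁] [InnerProductSpace ℝ E₁] [CompleteSpace E₁]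
  [NormedAddCommGroup E₂] {f : E₁ → ℝ} {β : ℝ≥0}

/-- The divergence between the dual points `(∇f(z'₁), z'₂)` and `(∇f(z₁), z₂)`, in terms of the
primal points `z₁` and `z'₁`: the Bregman divergence of `f^*` plus half the squared distance. -/
def diverg (f : E₁ → ℝ) (z z' : E₁ × E₂) : ℝ :=
  bregman f z.1 z'.1 + ‖z'.2 - z.2‖ ^ 2 / 2

theorem diverg_nonneg (hconv : ConvexOn ℝ univ f) {z' : E₁ × E₂}
    (hf : DifferentiableAt ℝ f z'.1) (z : E₁ × E₂) : 0 ≤ diverg f z z' :=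
  add_nonneg (bregman_nonneg hconv hf z.1) (by positivity)

theorem diverg_le (hf : Differentiable ℝ f) (hβ : LipschitzWith β (gradient f)) (z z' : E₁ × E₂) :
    diverg f z z' ≤ β / 2 * ‖z.1 - z'.1‖ ^ 2 + ‖z'.2 - z.2‖ ^ 2 / 2 :=
  add_le_add_left (bregman_le hf hβ z.1 z'.1) _

variable [InnerProductSpace ℝ E₂] {A : E₁ →L[ℝ] E₂} {b : E₂} {z z' : E₁ × E₂}

/-- The term `f^*(μ₁) + ⟨μ₂, b⟩ - ⟨μ₁, k⟩ - ⟨μ₂, A k⟩` of the dual cost at the point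
`μ = (∇f(z₁), z₂)`; the dual cost is its supremum over `k ∈ K`. -/
def cut (f : E₁ → ℝ) (A : E₁ →L[ℝ] E₂) (b : E₂) (z : E₁ × E₂) (k : E₁) : ℝ :=
  ⟪gradient f z.1, z.1 - k⟫_ℝ - f z.1 + ⟪z.2, b - A k⟫_ℝ

theorem cut_sub_cut_sq_le (hconv : ConvexOn ℝ univ f) (hf : Differentiable ℝ f)
    (hβ : LipschitzWith β (gradient f)) {k : E₁} (hk : cut f A b z' k ≤ cut f A b z k) :
    (cut f A b z k - cut f A b z' k) ^ 2 ≤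
      4 * (β * ‖z.1 - k‖ ^ 2 + ‖b - A k‖ ^ 2) * diverg f z z' := by
  set g := gradient f z.1 - gradient f z'.1 with hg
  have hle : cut f A b z k - cut f A b z' k ≤ ‖g‖ * ‖z.1 - k‖ + ‖z'.2 - z.2‖ * ‖b - A k‖ :=
    calc cut f A b z k - cut f A b z' k
        = ⟪g, z.1 - k⟫_ℝ + ⟪z.2 - z'.2, b - A k⟫_ℝ - bregman f z.1 z'.1 := by
          simp only [cut, bregman, hg, inner_sub_left, inner_sub_right]
          ring
      _ ≤ ⟪g, z.1 - k⟫_ℝ + ⟪z.2 - z'.2, b - A k⟫_ℝ :=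
          sub_le_self _ (bregman_nonneg hconv (hf _) _)
      _ ≤ ‖g‖ * ‖z.1 - k‖ + ‖z'.2 - z.2‖ * ‖b - A k‖ := by
          rw [norm_sub_rev z'.2]
          exact add_le_add (real_inner_le_norm _ _) (real_inner_le_norm _ _)
  calc (cut f A b z k - cut f A b z' k) ^ 2
      ≤ (‖g‖ * ‖z.1 - k‖ + ‖z'.2 - z.2‖ * ‖b - A k‖) ^ 2 :=
        pow_le_pow_left₀ (sub_nonneg.2 hk) hle 2
    _ ≤ 2 * (‖g‖ ^ 2 * ‖z.1 - k‖ ^ 2 + ‖z'.2 - z.2‖ ^ 2 * ‖b - A k‖ ^ 2) := by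
        rw [← mul_pow, ← mul_pow]
        exact add_sq_le
    _ ≤ 2 * (2 * (β * diverg f z z') * ‖z.1 - k‖ ^ 2 + 2 * diverg f z z' * ‖b - A k‖ ^ 2) := by
        have hbreg := norm_gradient_sub_sq_le_bregman hconv hf hβ z.1 z'.1
        have hnonneg := bregman_nonneg hconv (hf z'.1) z.1
        gcongr
        · refine hbreg.trans ?_
          rw [mul_assoc, diverg]
          gcongr
          linarith [sq_nonneg ‖z'.2 - z.2‖]
        · rw [diverg]
          linarith
    _ = 4 * (β * ‖z.1 - k‖ ^ 2 + ‖b - A k‖ ^ 2) * diverg f z z' := by ring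

theorem cut_eq_sub (f : E₁ → ℝ) (A : E₁ →L[ℝ] E₂) (b : E₂) (z : E₁ × E₂) :
    cut f A b z = fun k => (⟪gradient f z.1, z.1⟫_ℝ - f z.1 + ⟪z.2, b⟫_ℝ) -
      (innerSL ℝ (gradient f z.1) + (innerSL ℝ z.2).comp A) k := by
  ext k
  simp only [cut, inner_sub_right, add_apply, ContinuousLinearMap.comp_apply, innerSL_apply_apply]
  ring

end Cut

/-! ### Finite measures on compact sets -/

section Measure

theorem mass_nonneg {α : Type*} [MeasurableSpace α] (n : Measure α) : 0 ≤ mass n :=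
  measureReal_nonneg

theorem mass_add {α : Type*} [MeasurableSpace α] (n n₁ : Measure α) [IsFiniteMeasure n]
    [IsFiniteMeasure n₁] : mass (n + n₁) = mass n + mass n₁ :=
  measureReal_add_apply

theorem ae_mem_of_mem_posMeasures {α : Type*} [MeasurableSpace α] {S : Set α} {n : Measure α}
    (hn : n ∈ posMeasures S) : ∀ᵐ v ∂n, v ∈ S :=
  mem_ae_iff.2 hn.2

theorem zero_mem_posMeasures {α : Type*} [MeasurableSpace α] (S : Set α) :
    (0 : Measure α) ∈ posMeasures S :=
  ⟨inferInstance, rfl⟩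

theorem add_mem_posMeasures {α : Type*} [MeasurableSpace α] {S : Set α} {n n₁ : Measure α}
    (hn : n ∈ posMeasures S) (hn₁ : n₁ ∈ posMeasures S) : n + n₁ ∈ posMeasures S := by
  have := hn.1
  have := hn₁.1
  exact ⟨inferInstance, by simp [hn.2, hn₁.2]⟩

theorem smul_mem_posMeasures {α : Type*} [MeasurableSpace α] {S : Set α} {n : Measure α}
    (hn : n ∈ posMeasures S) (c : ℝ≥0) : c • n ∈ posMeasures S := by
  have := hn.1
  exact ⟨inferInstance, by simp [hn.2]⟩

theorem dirac_mem_posMeasures {α : Type*} [MeasurableSpace α] {S : Set α} (hS : MeasurableSet S)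
    {k : α} (hk : k ∈ S) : Measure.dirac k ∈ posMeasures S :=
  ⟨inferInstance, by simp [hS.compl, hk]⟩

variable {H : Type*} [NormedAddCommGroup H] [MeasurableSpace H] {S : Set H} {n n₁ : Measure H}

theorem norm_mean_le [InnerProductSpace ℝ H] {R : ℝ} (hR : ∀ v ∈ S, ‖v‖ ≤ R)
    (hn : n ∈ posMeasures S) : ‖mean n‖ ≤ R * mass n := by
  have := hn.1
  exact norm_integral_le_of_norm_le_const ((ae_mem_of_mem_posMeasures hn).mono hR)

variable [BorelSpace H]

theorem integrable_id_of_mem_posMeasures (hS : IsCompact S) (hn : n ∈ posMeasures S) :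
    Integrable (fun v : H => v) n := by
  have := hn.1
  obtain ⟨R, hR⟩ := hS.isBounded.exists_norm_le
  exact .of_bound (aestronglyMeasurable_iff_aemeasurable_separable.2
    ⟨aemeasurable_id, S, hS.isSeparable, ae_mem_of_mem_posMeasures hn⟩) R
    ((ae_mem_of_mem_posMeasures hn).mono hR)

theorem exists_mem_posMeasures_segment [InnerProductSpace ℝ H] (hS : IsCompact S)
    (hn : n ∈ posMeasures S) (hn₁ : n₁ ∈ posMeasures S) {ε : ℝ} (hε : ε ∈ Icc (0 : ℝ) 1) :
    ∃ m ∈ posMeasures S, mass m = mass n + ε * (mass n₁ - mass n) ∧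
      mean m = mean n + ε • (mean n₁ - mean n) := by
  have := hn.1
  have := hn₁.1
  lift ε to ℝ≥0 using hε.1
  obtain ⟨δ, hδ⟩ : ∃ δ : ℝ≥0, (δ : ℝ) = 1 - ε := ⟨⟨1 - ε, sub_nonneg.2 hε.2⟩, rfl⟩
  have hδn := smul_mem_posMeasures hn δ
  have hεn₁ := smul_mem_posMeasures hn₁ ε
  have := hδn.1
  have := hεn₁.1
  refine ⟨δ • n + ε • n₁, add_mem_posMeasures hδn hεn₁, ?_, ?_⟩
  · rw [mass_add]
    simp only [mass, measureReal_nnreal_smul_apply, hδ]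
    ring
  · rw [mean, integral_add_measure (integrable_id_of_mem_posMeasures hS hδn)
      (integrable_id_of_mem_posMeasures hS hεn₁), integral_smul_nnreal_measure,
      integral_smul_nnreal_measure, NNReal.smul_def, NNReal.smul_def, hδ]
    simp only [mean]
    module

end Measure

/-! ### The projection subproblem -/

section ProjStep

variable {E₁ E₂ : Type*} [NormedAddCommGroup E₁] [InnerProductSpace ℝ E₁]
  [NormedAddCommGroup E₂] [InnerProductSpace ℝ E₂]

theorem hasDerivAt_perspective [CompleteSpace E₁] {f : E₁ → ℝ} {s σ : ℝ} {x η : E₁} (hs : s ≠ 0)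
    (hf : DifferentiableAt ℝ f (s⁻¹ • x)) :
    HasDerivAt (fun ε : ℝ => (s + ε * σ) * f ((s + ε * σ)⁻¹ • (x + ε • η)))
      (σ * f (s⁻¹ • x) + ⟪gradient f (s⁻¹ • x), η - σ • s⁻¹ • x⟫_ℝ) 0 := by
  have hscale : HasDerivAt (fun ε : ℝ => s + ε * σ) σ 0 := by
    simpa using ((hasDerivAt_id (0 : ℝ)).mul_const σ).const_add s
  have hnum : HasDerivAt (fun ε : ℝ => x + ε • η) η 0 := by
    simpa using ((hasDerivAt_id (0 : ℝ)).smul_const η).const_add x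
  have hpt : HasDerivAt (fun ε : ℝ => (s + ε * σ)⁻¹ • (x + ε • η))
      (s⁻¹ • (η - σ • s⁻¹ • x)) 0 := by
    refine ((hscale.fun_inv (by simpa)).smul hnum).congr_deriv ?_
    simp only [zero_mul, zero_smul, add_zero]
    match_scalars <;> field_simp
  have hf' : HasFDerivAt f (fderiv ℝ f (s⁻¹ • x)) ((s + 0 * σ)⁻¹ • (x + (0 : ℝ) • η)) := by
    simpa using hf.hasFDerivAt
  refine (hscale.mul (hf'.comp_hasDerivAt 0 hpt)).congr_deriv ?_
  simp only [Function.comp_apply, zero_mul, zero_smul, add_zero, map_smul, inner_gradient_left,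
    smul_eq_mul, mul_inv_cancel_left₀ hs]

variable [MeasurableSpace E₁]

theorem projCost_eq_coe (f : E₁ → ℝ) (A : E₁ →L[ℝ] E₂) (b : E₂) (Q : Set E₂) (w : E₁) (q : E₂)
    (ℓ : ℝ) (n : Measure E₁) :
    projCost f A b Q w q ℓ n = (((1 + mass n) * f ((1 + mass n)⁻¹ • (mean n + w))
      + (‖shifted A b q n‖ ^ 2 - Metric.infDist (shifted A b q n) Q ^ 2) / 2
      + ℓ * mass n : ℝ) : EReal) := by
  simp [projCost, persp, add_pos_of_pos_of_nonneg one_pos (mass_nonneg n)]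

/-- A step of the method from `z = (w₁^t, μ₂^t)` to `z' = (w₁^{t+1}, μ₂^{t+1})`: the measure `-n`
solves the projection subproblem over `S` at level `ℓ`. -/
structure IsProjStep (f : E₁ → ℝ) (A : E₁ →L[ℝ] E₂) (b : E₂) (Q : Set E₂) (S : Set E₁) (ℓ : ℝ)
    (z : E₁ × E₂) (n : Measure E₁) (z' : E₁ × E₂) : Prop where
  isSolution : IsSolution (projCost f A b Q z.1 z.2 ℓ) (posMeasures S) n
  fst_eq : z'.1 = (1 + mass n)⁻¹ • (z.1 + mean n)
  snd_proj : IsSolution (fun q => ‖shifted A b z.2 n - q‖) Q z'.2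

variable [BorelSpace E₁] [CompleteSpace E₁] {f : E₁ → ℝ} {A : E₁ →L[ℝ] E₂} {b : E₂} {Q : Set E₂}
  {S : Set E₁} {ℓ : ℝ} {z z' y : E₁ × E₂} {n n₁ : Measure E₁}

theorem integrable_cut (hS : IsCompact S) (hn : n ∈ posMeasures S) :
    Integrable (cut f A b z) n := by
  have := hn.1
  have hid := integrable_id_of_mem_posMeasures hS hn
  simp only [cut_eq_sub]
  exact (integrable_const _).sub (ContinuousLinearMap.integrable_comp _ hid)

theorem integral_cut (hS : IsCompact S) (hn : n ∈ posMeasures S) :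
    ∫ k, cut f A b z k ∂n = mass n * (⟪gradient f z.1, z.1⟫_ℝ - f z.1 + ⟪z.2, b⟫_ℝ) -
      (⟪gradient f z.1, mean n⟫_ℝ + ⟪z.2, A (mean n)⟫_ℝ) := by
  have := hn.1
  have hid := integrable_id_of_mem_posMeasures hS hn
  rw [cut_eq_sub, integral_sub (integrable_const _) (ContinuousLinearMap.integrable_comp _ hid),
    integral_const, ContinuousLinearMap.integral_comp_comm _ hid]
  rfl

/-- The first-order optimality condition of the projection subproblem. -/
theorem IsProjStep.integral_cut_sub_le (hf : DifferentiableAt ℝ f z'.1) (hQ : Convex ℝ Q)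
    (hS : IsCompact S) (h : IsProjStep f A b Q S ℓ z n z') (hn₁ : n₁ ∈ posMeasures S) :
    ∫ k, cut f A b z' k ∂n₁ - ℓ * mass n₁ ≤ ∫ k, cut f A b z' k ∂n - ℓ * mass n := by
  have hn := h.isSolution.1
  set σ := mass n₁ - mass n with hσ
  set η := mean n₁ - mean n with hη
  set d := A η - σ • b with hd
  have hfst : (1 + mass n)⁻¹ • (mean n + z.1) = z'.1 := by rw [h.fst_eq, add_comm z.1]
  have hpersp := hasDerivAt_perspective (σ := σ) (η := η)
    (add_pos_of_pos_of_nonneg one_pos (mass_nonneg n)).ne' (hfst ▸ hf)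
  have hquad : HasDerivAt (fun ε : ℝ => ε * (⟪z'.2, d⟫_ℝ + ℓ * σ) + ε ^ 2 * (‖d‖ ^ 2 / 2))
      (⟪z'.2, d⟫_ℝ + ℓ * σ) 0 :=
    (((hasDerivAt_id (0 : ℝ)).mul_const _).add
      (((hasDerivAt_id (0 : ℝ)).pow 2).mul_const _)).congr_deriv (by simp)
  have hderiv := nonneg_of_hasDerivAt_of_forall_le (hpersp.add hquad) fun ε hε => ?_
  · rw [hfst] at hderiv
    rw [integral_cut hS hn₁, integral_cut hS hn]
    simp only [hσ, hη, hd, inner_sub_right, inner_smul_right, map_sub] at hderiv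
    linarith
  · obtain ⟨m, hm, hmass, hmean⟩ := exists_mem_posMeasures_segment hS hn hn₁
      (Ioc_subset_Icc_self hε)
    have hshift : shifted A b z.2 m = shifted A b z.2 n + ε • d := by
      simp only [shifted, hmass, hmean, hd, map_add, map_smul]
      module
    have hmin := h.isSolution.2 m hm
    have hdist := h.snd_proj.norm_sq_sub_infDist_sq_le hQ (ε • d)
    rw [projCost_eq_coe, projCost_eq_coe, EReal.coe_le_coe_iff, hshift, hmass, hmean] at hmin
    rw [inner_smul_right, norm_smul, mul_pow, Real.norm_eq_abs, sq_abs] at hdist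
    simp only [Pi.add_apply, zero_mul, zero_smul, add_zero, zero_pow two_ne_zero]
    rw [← add_assoc, add_right_comm (mean n), ← hσ, ← hη] at hmin
    linarith

theorem IsProjStep.cut_le_level (hf : DifferentiableAt ℝ f z'.1) (hQ : Convex ℝ Q)
    (hS : IsCompact S) (h : IsProjStep f A b Q S ℓ z n z') {k : E₁} (hk : k ∈ S) :
    cut f A b z' k ≤ ℓ := by
  have hn := h.isSolution.1
  have := hn.1
  have hδ := dirac_mem_posMeasures hS.measurableSet hk
  have hle := h.integral_cut_sub_le hf hQ hS (add_mem_posMeasures hn hδ)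
  rw [integral_add_measure (integrable_cut hS hn) (integrable_cut hS hδ), integral_dirac] at hle
  have hmass : mass (Measure.dirac k) = 1 := probReal_univ
  rw [mass_add, hmass] at hle
  linarith

theorem IsProjStep.level_mul_mass_le (hf : DifferentiableAt ℝ f z'.1) (hQ : Convex ℝ Q)
    (hS : IsCompact S) (h : IsProjStep f A b Q S ℓ z n z') :
    ℓ * mass n ≤ ∫ k, cut f A b z' k ∂n := by
  simpa [mass] using h.integral_cut_sub_le hf hQ hS (zero_mem_posMeasures S)

theorem IsProjStep.diverg_add_diverg_sub_le (hconv : ConvexOn ℝ univ f)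
    (hf : DifferentiableAt ℝ f y.1) (hQ : Convex ℝ Q) (hS : IsCompact S)
    (h : IsProjStep f A b Q S ℓ z n z') (hy : y.2 ∈ Q) :
    diverg f z' y + diverg f z z' - diverg f z y ≤
      ∫ k, cut f A b y k ∂n - ∫ k, cut f A b z' k ∂n := by
  have hn := h.isSolution.1
  have hbreg : bregman f z'.1 y.1 + bregman f z.1 z'.1 - bregman f z.1 y.1 =
      mass n * ⟪gradient f y.1 - gradient f z'.1, z'.1⟫_ℝ -
        ⟪gradient f y.1 - gradient f z'.1, mean n⟫_ℝ := by
    have hz : z.1 - z'.1 = mass n • z'.1 - mean n := by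
      have hsum : (1 + mass n) • z'.1 = z.1 + mean n := by
        rw [h.fst_eq, smul_inv_smul₀ (add_pos_of_pos_of_nonneg one_pos (mass_nonneg n)).ne']
      rw [sub_eq_sub_iff_add_eq_add, ← hsum]
      module
    rw [bregman_three_point, hz, inner_sub_right, inner_smul_right]
  have hnorm : ⟪y.2 - z'.2, z.2 - z'.2⟫_ℝ ≤
      mass n * ⟪y.2 - z'.2, b⟫_ℝ - ⟪y.2 - z'.2, A (mean n)⟫_ℝ := by
    have hproj := h.snd_proj.inner_sub_le_zero hQ y.2 hy
    have hshift : shifted A b z.2 n - z'.2 = (z.2 - z'.2) - (mass n • b - A (mean n)) := by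
      rw [shifted]
      abel
    rwa [hshift, real_inner_comm, inner_sub_right, sub_nonpos, inner_sub_right _ (mass n • b),
      inner_smul_right] at hproj
  have hthree := norm_sub_sq_three_point z'.2 z.2 y.2
  have hmass := mul_nonneg (mass_nonneg n) (bregman_nonneg hconv hf z'.1)
  rw [integral_cut hS hn, integral_cut hS hn]
  simp only [diverg, bregman, inner_sub_left, inner_sub_right] at *
  linarith

theorem IsProjStep.diverg_add_diverg_le (hconv : ConvexOn ℝ univ f) (hf : Differentiable ℝ f)
    (hQ : Convex ℝ Q) (hS : IsCompact S) (h : IsProjStep f A b Q S ℓ z n z') (hy : y.2 ∈ Q)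
    {ε : ℝ} (hcut : ∀ k ∈ S, cut f A b y k ≤ ℓ + ε) :
    diverg f z' y + diverg f z z' ≤ diverg f z y + ε * mass n := by
  have hn := h.isSolution.1
  have := hn.1
  have hint : ∫ k, cut f A b y k ∂n ≤ (ℓ + ε) * mass n := by
    refine (integral_mono_ae (integrable_cut hS hn) (integrable_const _)
      ((ae_mem_of_mem_posMeasures hn).mono hcut)).trans_eq ?_
    simp [mass, mul_comm]
  linarith [h.diverg_add_diverg_sub_le hconv (hf y.1) hQ hS hy, h.level_mul_mass_le (hf z'.1) hQ hS]

end ProjStep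

section ProjSteps

variable {E₁ E₂ : Type*} [NormedAddCommGroup E₁] [InnerProductSpace ℝ E₁] [CompleteSpace E₁]
  [MeasurableSpace E₁] [BorelSpace E₁] [NormedAddCommGroup E₂] [InnerProductSpace ℝ E₂]
  {f : E₁ → ℝ} {A : E₁ →L[ℝ] E₂} {b : E₂} {Q : Set E₂}
  {z : ℕ → E₁ × E₂} {n : ℕ → Measure E₁} {S : ℕ → Set E₁} {ℓ : ℕ → ℝ} {s t : ℕ}

theorem diverg_add_sum_diverg_le (hconv : ConvexOn ℝ univ f) (hf : Differentiable ℝ f)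
    (hQ : Convex ℝ Q) (hst : s ≤ t)
    (hS : ∀ j ∈ Ioc s t, IsCompact (S j))
    (h : ∀ j ∈ Ioc s t, IsProjStep f A b Q (S j) (ℓ j) (z j) (n j) (z (j + 1)))
    {y : E₁ × E₂} (hy : y.2 ∈ Q) {ε : ℝ}
    (hcut : ∀ j ∈ Ioc s t, ∀ k ∈ S j, cut f A b y k ≤ ℓ j + ε) :
    diverg f (z (t + 1)) y + ∑ j ∈ Finset.Ioc s t, diverg f (z j) (z (j + 1)) ≤
      diverg f (z (s + 1)) y + ε * ∑ j ∈ Finset.Ioc s t, mass (n j) := by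
  induction t, hst using Nat.le_induction with
  | base => simp
  | succ t hst ih =>
    have hsub : Ioc s t ⊆ Ioc s (t + 1) := Ioc_subset_Ioc_right t.le_succ
    have hmem : t + 1 ∈ Ioc s (t + 1) := ⟨by lia, le_rfl⟩
    have hprev := ih (fun j hj => hS j (hsub hj)) (fun j hj => h j (hsub hj))
      fun j hj => hcut j (hsub hj)
    have hstep := (h _ hmem).diverg_add_diverg_le hconv hf hQ (hS _ hmem) hy (hcut _ hmem)
    rw [Finset.sum_Ioc_succ_top hst, Finset.sum_Ioc_succ_top hst]
    linarith

theorem sum_diverg_le (hconv : ConvexOn ℝ univ f) (hf : Differentiable ℝ f)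
    (hQ : Convex ℝ Q) (hst : s ≤ t)
    (hS : ∀ j ∈ Ioc s t, IsCompact (S j))
    (h : ∀ j ∈ Ioc s t, IsProjStep f A b Q (S j) (ℓ j) (z j) (n j) (z (j + 1))) {D : ℝ}
    (hy : ∀ ε ∈ Ioc (0 : ℝ) 1, ∃ y : E₁ × E₂, y.2 ∈ Q ∧ diverg f (z (s + 1)) y ≤ D ∧
      ∀ j ∈ Ioc s t, ∀ k ∈ S j, cut f A b y k ≤ ℓ j + ε) :
    ∑ j ∈ Finset.Ioc s t, diverg f (z j) (z (j + 1)) ≤ D := by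
  have hlim : Filter.Tendsto (fun ε => D + ε * ∑ j ∈ Finset.Ioc s t, mass (n j)) (𝓝[>] 0) (𝓝 D) :=
    tendsto_nhdsWithin_of_tendsto_nhds (Continuous.tendsto' (by fun_prop) _ _ (by simp))
  refine ge_of_tendsto hlim (Filter.mem_of_superset (Ioc_mem_nhdsGT one_pos) fun ε hε => ?_)
  obtain ⟨y, hyQ, hyD, hcut⟩ := hy ε hε
  have hsum := diverg_add_sum_diverg_le hconv hf hQ hst hS h hyQ hcut
  have hlast := diverg_nonneg hconv (hf y.1) (z (t + 1))
  rw [mem_ofPred_eq]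
  linarith

end ProjSteps

/-! ### Closed convex hulls -/

section Hull

variable {H : Type*} [NormedAddCommGroup H] [InnerProductSpace ℝ H] {S C : Set H}

theorem subset_cconv (S : Set H) : S ⊆ cconv S :=
  (subset_convexHull ℝ S).trans subset_closure

theorem convex_cconv (S : Set H) : Convex ℝ (cconv S) :=
  (convex_convexHull ℝ S).closure

theorem cconv_subset (hC : IsClosed C) (hC' : Convex ℝ C) (h : S ⊆ C) : cconv S ⊆ C :=
  closure_minimal (convexHull_min h hC') hC

theorem cconv_mono (h : S ⊆ C) : cconv S ⊆ cconv C :=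
  closure_mono (convexHull_mono h)

theorem cconv_neg (S : Set H) : cconv (-S) = -cconv S := by
  rw [cconv, cconv, convexHull_neg]
  exact ((Homeomorph.neg H).preimage_closure _).symm

theorem isCompact_cconv [CompleteSpace H] (hS : IsCompact S) : IsCompact (cconv S) :=
  hS.totallyBounded.convexHull.closure.isCompact_of_isClosed isClosed_closure

end Hull

/-! ### Lifting to the graph -/

section Lift

variable {E₁ E₂ : Type*} [NormedAddCommGroup E₁] [InnerProductSpace ℝ E₁]
  [NormedAddCommGroup E₂] [InnerProductSpace ℝ E₂] {A : E₁ →L[ℝ] E₂} {S : Set E₁}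

/-- The embedding `x ↦ (x, A x)` of `E₁` onto the graph of `A`. -/
def graphMap (A : E₁ →L[ℝ] E₂) : E₁ →L[ℝ] WithLp 2 (E₁ × E₂) :=
  (WithLp.prodContinuousLinearEquiv 2 ℝ E₁ E₂).symm ∘L (ContinuousLinearMap.id ℝ E₁).prod A

theorem eq_graphMap_iff {x : WithLp 2 (E₁ × E₂)} {y : E₁} :
    x = graphMap A y ↔ x.fst = y ∧ x.snd = A y :=
  ⟨by rintro rfl; exact ⟨rfl, rfl⟩, fun h => WithLp.ofLp_injective 2 (Prod.ext h.1 h.2)⟩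

theorem graphOver_eq_image (A : E₁ →L[ℝ] E₂) (S : Set E₁) : graphOver A S = graphMap A '' S := by
  ext x
  constructor
  · exact fun hx => ⟨x.fst, hx.1, (eq_graphMap_iff.2 ⟨rfl, hx.2⟩).symm⟩
  · rintro ⟨y, hy, rfl⟩
    exact ⟨hy, rfl⟩

theorem neg_graphOver (A : E₁ →L[ℝ] E₂) (S : Set E₁) : -graphOver A S = graphOver A (-S) := by
  ext x
  simp [graphOver]

theorem cconv_graphOver (A : E₁ →L[ℝ] E₂) (S : Set E₁) :
    cconv (graphOver A S) = graphOver A (cconv S) := by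
  have hemb : Topology.IsClosedEmbedding (graphMap A) :=
    Function.LeftInverse.isClosedEmbedding (f := WithLp.fst) (fun _ => rfl)
      (WithLp.continuous_fst 2 E₁ E₂) (graphMap A).continuous
  rw [graphOver_eq_image, graphOver_eq_image, cconv, cconv, ← hemb.closure_image_eq]
  exact congrArg closure ((graphMap A).toLinearMap.image_convexHull S).symm

theorem Trace.neg_Etilde [MeasurableSpace E₁] (T : Trace E₁ E₂) (A : E₁ →L[ℝ] E₂) (t : ℕ) :
    -T.Etilde A t = graphOver A (T.Ktilde t) := by
  have hpt : {WithLp.toLp 2 (T.v t, A (T.v t))} = graphOver A {T.v t} := by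
    rw [graphOver_eq_image, image_singleton]
    rfl
  rw [Etilde, hpt, graphOver_eq_image, graphOver_eq_image, ← image_union, ← graphOver_eq_image,
    cconv_graphOver, neg_graphOver, ← cconv_neg, union_neg, neg_neg, neg_singleton, Ktilde]

theorem isSolution_liftedCost_graphOver_iff {f : E₁ → ℝ} {b : E₂} {Q : Set E₂}
    {x : WithLp 2 (E₁ × E₂)} :
    IsSolution (liftedCost f b Q) (graphOver A S) x ↔
      IsSolution (cost f A b Q) S x.fst ∧ x.snd = A x.fst := by
  refine ⟨fun hx => ⟨⟨hx.1.1, fun y hy => ?_⟩, hx.1.2⟩, fun hx => ⟨⟨hx.1.1, hx.2⟩, fun y hy => ?_⟩⟩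
  · rw [cost, ← hx.1.2]
    exact hx.2 (graphMap A y) ⟨hy, rfl⟩
  · rw [liftedCost, liftedCost, hx.2, hy.2]
    exact hx.1.2 y.fst hy.1

end Lift

/-! ### Duality -/

section Lagrangian

variable {E₁ E₂ : Type*} [NormedAddCommGroup E₁] [InnerProductSpace ℝ E₁]
  [NormedAddCommGroup E₂] [InnerProductSpace ℝ E₂]

/-- The Lagrangian whose supremum over `q ∈ Q` is the cost `f(x) + σ_Q(A x - b)`. -/
def lagrangian (f : E₁ → ℝ) (A : E₁ →L[ℝ] E₂) (b : E₂) (x : E₁) (q : E₂) : ℝ :=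
  f x + ⟪A x - b, q⟫_ℝ

variable {f : E₁ → ℝ} {A : E₁ →L[ℝ] E₂} {b : E₂} {Q Q₁ Q₂ : Set E₂} {K X : Set E₁}

theorem cost_le_coe_iff {x : E₁} {c : ℝ} :
    cost f A b Q x ≤ c ↔ ∀ q ∈ Q, lagrangian f A b x q ≤ c := by
  rw [cost, add_comm, ← EReal.le_sub_iff_add_le (.inl (EReal.coe_ne_bot _))
    (.inl (EReal.coe_ne_top _)), supp, iSup₂_le_iff]
  simp only [← EReal.coe_sub, EReal.coe_le_coe_iff, lagrangian, le_sub_iff_add_le']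

theorem lagrangian_le_cost {x : E₁} {q : E₂} (hq : q ∈ Q) :
    (lagrangian f A b x q : EReal) ≤ cost f A b Q x := by
  rw [lagrangian, EReal.coe_add, cost]
  gcongr
  exact le_iSup₂_of_le q hq le_rfl

theorem convexOn_lagrangian (hf : ConvexOn ℝ X f) (q : E₂) :
    ConvexOn ℝ X fun x => lagrangian f A b x q := by
  have hlin := (((innerSL ℝ q).comp A).toLinearMap.convexOn hf.1).add_const (-⟪b, q⟫_ℝ)
  refine (hf.add hlin).congr fun x _ => ?_
  simp [lagrangian, real_inner_comm q, inner_sub_right, ← sub_eq_add_neg]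

theorem concaveOn_lagrangian (hQ : Convex ℝ Q) (x : E₁) : ConcaveOn ℝ Q (lagrangian f A b x) :=
  (concaveOn_const (f x) hQ).add ((innerSL ℝ (A x - b)).toLinearMap.concaveOn hQ)

theorem continuous_lagrangian_left (hf : Continuous f) (q : E₂) :
    Continuous fun x => lagrangian f A b x q := by
  unfold lagrangian
  fun_prop

theorem continuous_lagrangian_right (x : E₁) : Continuous (lagrangian f A b x) := by
  unfold lagrangian
  fun_prop

/-- Sion's minimax theorem applies to a finite subset of `Q`, which suffices by compactness. -/
theorem exists_forall_lt_lagrangian (hconv : ConvexOn ℝ X f) (hcont : Continuous f)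
    (hQ : Convex ℝ Q) (hX : IsCompact X) (hne : X.Nonempty) {c : ℝ}
    (h : ∀ x ∈ X, ∃ q ∈ Q, c < lagrangian f A b x q) :
    ∃ q ∈ Q, ∀ x ∈ X, c < lagrangian f A b x q := by
  obtain ⟨s, hsQ, hs, hcover⟩ := hX.elim_finite_subcover_image
    (c := fun q => {x | c < lagrangian f A b x q})
    (fun q _ => isOpen_lt continuous_const (continuous_lagrangian_left hcont q))
    (fun x hx => by simpa using h x hx)
  exact Sion.exists_lt_iInf_of_lt_iInf_of_finite (f := lagrangian f A b) hne hX
    (fun q _ => (continuous_lagrangian_left hcont q).lowerSemicontinuous.lowerSemicontinuousOn X)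
    (fun q _ => (convexOn_lagrangian hconv q).quasiconvexOn) hQ
    (fun x _ => (continuous_lagrangian_right x).upperSemicontinuous.upperSemicontinuousOn Q)
    (fun x _ => (concaveOn_lagrangian hQ x).quasiconcaveOn) hconv.1 hs hsQ
    (fun x hx => by simpa using hcover hx)

theorem inner_le_of_mem_polar_of_mem_add {B : ℝ} (hB : ∀ q ∈ Q₁, ‖q‖ ≤ B) {p q : E₂}
    (hp : p ∈ polar Q₂) (hq : q ∈ Q₁ + Q₂) : ⟪p, q⟫_ℝ ≤ ‖p‖ * B := by
  obtain ⟨q₁, hq₁, q₂, hq₂, rfl⟩ := hq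
  have hpq₁ : ⟪p, q₁⟫_ℝ ≤ ‖p‖ * B :=
    (real_inner_le_norm p q₁).trans (mul_le_mul_of_nonneg_left (hB q₁ hq₁) (norm_nonneg p))
  have hpq₂ : ⟪p, q₂⟫_ℝ ≤ 0 := real_inner_comm q₂ p ▸ hp q₂ hq₂
  rw [inner_add_right]
  linarith

theorem exists_cost_ne_top (hQ : Q ⊆ Q₁ + Q₂) (hQ₁ : Bornology.IsBounded Q₁)
    (hqualif : -b ∈ polar Q₂ - A '' X) : ∃ x ∈ X, cost f A b Q x ≠ ⊤ := by
  obtain ⟨p, hp, _, ⟨x, hx, rfl⟩, hpx⟩ := hqualif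
  obtain ⟨B, hB⟩ := hQ₁.exists_norm_le
  have hAx : A x - b = p := by rw [sub_eq_add_neg, ← hpx, add_sub_cancel]
  refine ⟨x, hx, ne_top_of_le_ne_top (EReal.coe_ne_top (f x + ‖p‖ * B)) ?_⟩
  refine cost_le_coe_iff.2 fun q hq => add_le_add_right ?_ (f x)
  rw [hAx]
  exact inner_le_of_mem_polar_of_mem_add hB hp (hQ hq)

theorem neg_lagrangian_le_dualCost {μ : WithLp 2 (E₁ × E₂)} (hμ : μ.snd ∈ Q) {x : E₁}
    (hx : x ∈ K) : ((-lagrangian f A b x μ.snd : ℝ) : EReal) ≤ dualCost f A b Q K μ := by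
  have hconj : ((⟪μ.fst, x⟫_ℝ - f x : ℝ) : EReal) ≤ conj f μ.fst :=
    le_iSup (fun x => ((⟪μ.fst, x⟫_ℝ - f x : ℝ) : EReal)) x
  have hsupp : ((⟪μ, -graphMap A x⟫_ℝ : ℝ) : EReal) ≤ supp (-graphOver A K) μ :=
    le_iSup₂_of_le (-graphMap A x) (neg_mem_neg.2 ⟨hx, rfl⟩) le_rfl
  refine le_trans (le_of_eq ?_)
    (add_le_add (add_le_add_left (add_le_add_left hconj _) _) hsupp)
  have hinner : ⟪μ, graphMap A x⟫_ℝ = ⟪μ.fst, x⟫_ℝ + ⟪μ.snd, A x⟫_ℝ := WithLp.prod_inner_apply ..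
  rw [indic, if_pos hμ, add_zero, ← EReal.coe_add, ← EReal.coe_add, inner_neg_right, hinner,
    lagrangian, inner_sub_left, real_inner_comm b, real_inner_comm (A x)]
  congr 1
  ring

theorem neg_dualCost_le_cost {μ : WithLp 2 (E₁ × E₂)} (hμ : μ.snd ∈ Q) {x : E₁} (hx : x ∈ K) :
    -dualCost f A b Q K μ ≤ cost f A b Q x := by
  refine le_trans ?_ (lagrangian_le_cost hμ)
  rw [EReal.neg_le, ← EReal.coe_neg]
  exact neg_lagrangian_le_dualCost hμ hx

end Lagrangian

section CutDuality

variable {E₁ E₂ : Type*} [NormedAddCommGroup E₁] [InnerProductSpace ℝ E₁] [CompleteSpace E₁]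
  [NormedAddCommGroup E₂] [InnerProductSpace ℝ E₂]
  {f : E₁ → ℝ} {A : E₁ →L[ℝ] E₂} {b : E₂} {Q Q₁ Q₂ : Set E₂} {K S X : Set E₁}

theorem supp_neg_graphOver [CompleteSpace E₂] {μ : WithLp 2 (E₁ × E₂)} {k : E₁}
    (hk : IsSolution (fun x => ⟪μ.fst + A.adjoint μ.snd, x⟫_ℝ) K k) :
    supp (-graphOver A K) μ = ((-⟪μ.fst + A.adjoint μ.snd, k⟫_ℝ : ℝ) : EReal) := by
  have hinner (x : E₁) : ⟪μ, -graphMap A x⟫_ℝ = -⟪μ.fst + A.adjoint μ.snd, x⟫_ℝ := by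
    rw [inner_neg_right, inner_add_left, ContinuousLinearMap.adjoint_inner_left]
    rfl
  refine le_antisymm (iSup₂_le fun x hx => ?_) ?_
  · obtain ⟨y, hy, hyx⟩ := graphOver_eq_image A K ▸ mem_neg.1 hx
    rw [← neg_neg x, ← hyx, hinner, EReal.coe_le_coe_iff, neg_le_neg_iff]
    exact hk.2 y hy
  · rw [← hinner]
    exact le_iSup₂_of_le (-graphMap A k) (neg_mem_neg.2 ⟨hk.1, rfl⟩) le_rfl

theorem dualCost_eq_cut [CompleteSpace E₂] (hconv : ConvexOn ℝ univ f) {w : E₁}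
    (hf : DifferentiableAt ℝ f w) {μ : WithLp 2 (E₁ × E₂)} (hμ₁ : μ.fst = gradient f w)
    (hμ₂ : μ.snd ∈ Q) {k : E₁} (hk : IsSolution (fun x => ⟪μ.fst + A.adjoint μ.snd, x⟫_ℝ) K k) :
    dualCost f A b Q K μ = cut f A b (w, μ.snd) k := by
  rw [dualCost, supp_neg_graphOver hk, hμ₁, conj_gradient hconv hf, indic, if_pos hμ₂, add_zero,
    ← EReal.coe_add, ← EReal.coe_add, EReal.coe_eq_coe_iff, cut, inner_add_left,
    ContinuousLinearMap.adjoint_inner_left, inner_sub_right, inner_sub_right]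
  ring

theorem neg_lagrangian_le_cut (hconv : ConvexOn ℝ univ f) {z : E₁ × E₂}
    (hf : DifferentiableAt ℝ f z.1) (k : E₁) : -lagrangian f A b k z.2 ≤ cut f A b z k := by
  have hgrad := inner_gradient_le_sub hconv hf k
  rw [lagrangian, cut, ← neg_sub k, inner_neg_right, ← neg_sub b, inner_neg_left, real_inner_comm]
  linarith

/-- The first-order optimality condition of the minimization of the Lagrangian over `X`. -/
theorem cut_le_neg_lagrangian_of_isMinOn (hX : Convex ℝ X) {y : E₁}
    (hf : DifferentiableAt ℝ f y) {q : E₂} (hy : y ∈ X)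
    (hmin : IsMinOn (fun x => lagrangian f A b x q) X y) {x : E₁} (hx : x ∈ X) :
    cut f A b (y, q) x ≤ -lagrangian f A b y q := by
  have hderiv : HasDerivAt (fun ε : ℝ => f (y + ε • (x - y)) + ε * ⟪A (x - y), q⟫_ℝ)
      (⟪gradient f y, x - y⟫_ℝ + ⟪A (x - y), q⟫_ℝ) 0 := by
    have hline := hasDerivAt_comp_add_smul (f := f) (x := y) (d := x - y) (s := 0) (by simpa)
    exact (hline.add ((hasDerivAt_id (0 : ℝ)).mul_const _)).congr_deriv (by simp)
  have hnonneg := nonneg_of_hasDerivAt_of_forall_le hderiv fun ε hε => ?_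
  · rw [cut, lagrangian, ← neg_sub x, inner_neg_right, real_inner_comm (b - A x)]
    simp only [map_sub, inner_sub_left] at hnonneg ⊢
    linarith
  · have hle := isMinOn_iff.1 hmin _ (hX.add_smul_sub_mem hy hx (Ioc_subset_Icc_self hε))
    simp only [lagrangian, map_add, map_smul, inner_sub_left, inner_add_left,
      inner_smul_left, RCLike.conj_to_real] at hle
    simp only [zero_smul, add_zero, zero_mul]
    linarith

theorem exists_forall_cut_le (hconv : ConvexOn ℝ univ f) (hf : Differentiable ℝ f)
    (hQ : Convex ℝ Q) (hX : IsCompact X) (hX' : Convex ℝ X) (hne : X.Nonempty) {c : ℝ}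
    (h : ∀ x ∈ X, (c : EReal) < cost f A b Q x) :
    ∃ y ∈ X, ∃ q ∈ Q, ∀ x ∈ X, cut f A b (y, q) x ≤ -c := by
  have hlt : ∀ x ∈ X, ∃ q ∈ Q, c < lagrangian f A b x q := fun x hx => by
    simpa using mt cost_le_coe_iff.2 (h x hx).not_ge
  obtain ⟨q, hq, hcq⟩ := exists_forall_lt_lagrangian (hconv.subset (subset_univ X) hX')
    hf.continuous hQ hX hne hlt
  obtain ⟨y, hy, hmin⟩ :=
    hX.exists_isMinOn hne (continuous_lagrangian_left hf.continuous q).continuousOn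
  exact ⟨y, hy, q, hq, fun x hx =>
    (cut_le_neg_lagrangian_of_isMinOn hX' (hf y) hy hmin hx).trans (neg_le_neg (hcq y hy).le)⟩

theorem cut_le_of_mem_cconv {z : E₁ × E₂} {c : ℝ} (h : ∀ k ∈ S, cut f A b z k ≤ c) {k : E₁}
    (hk : k ∈ cconv S) : cut f A b z k ≤ c := by
  simp only [cut_eq_sub, sub_le_comm (c := c)] at h ⊢
  exact cconv_subset (C := {k | _ ≤ (innerSL ℝ (gradient f z.1) + (innerSL ℝ z.2).comp A) k})
    (isClosed_le continuous_const (ContinuousLinearMap.continuous _))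
    (convex_halfSpace_ge (ContinuousLinearMap.toLinearMap _).isLinear _) h hk

theorem norm_le_of_forall_inner_le {q : E₂} {r M : ℝ} (hr : 0 < r)
    (h : ∀ u : E₂, ‖u‖ ≤ r → ⟪u, q⟫_ℝ ≤ M) : ‖q‖ ≤ M / r := by
  rw [le_div_iff₀ hr]
  rcases eq_or_ne q 0 with rfl | hq
  · simpa using h 0 (by simpa using hr.le)
  · have hq' := norm_ne_zero_iff.2 hq
    have hle := h ((r / ‖q‖) • q) (by
      rw [norm_smul, Real.norm_of_nonneg (by positivity), div_mul_cancel₀ r hq'])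
    rw [real_inner_smul_left, real_inner_self_eq_norm_sq] at hle
    calc ‖q‖ * r = r / ‖q‖ * ‖q‖ ^ 2 := by field_simp
      _ ≤ M := hle

/-- The qualification condition allows testing the bound in all directions of `E₂`. -/
theorem exists_norm_snd_le_of_cut_le (hconv : ConvexOn ℝ univ f) (hf : Differentiable ℝ f)
    (hQ : Q ⊆ Q₁ + Q₂) (hQ₁ : Bornology.IsBounded Q₁) (hS : IsCompact S)
    (hqualif : -b ∈ interior (polar Q₂ - A '' cconv S)) (c : ℝ) :
    ∃ M : ℝ, ∀ z : E₁ × E₂, z.2 ∈ Q → (∀ k ∈ S, cut f A b z k ≤ c) → ‖z.2‖ ≤ M := by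
  obtain ⟨r, hr, hball⟩ :=
    Metric.nhds_basis_closedBall.mem_iff.1 (mem_interior_iff_mem_nhds.1 hqualif)
  obtain ⟨B, hB⟩ := hQ₁.exists_norm_le
  have hcS := isCompact_cconv hS
  obtain ⟨R, hR⟩ := hcS.exists_bound_of_continuousOn A.continuous.continuousOn
  obtain ⟨F, hF⟩ := hcS.bddAbove_image hf.continuous.continuousOn
  refine ⟨((r + ‖b‖ + R) * B + c + F) / r, fun z hz hcut => norm_le_of_forall_inner_le hr ?_⟩
  intro u hu
  obtain ⟨p, hp, _, ⟨k, hk, rfl⟩, hpk⟩ := hball (show -b + u ∈ Metric.closedBall (-b) r by simpa)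
  have hpu : p = u - b + A k := by
    rw [← sub_eq_iff_eq_add, sub_eq_neg_add u]
    exact hpk
  have hpnorm : ‖p‖ ≤ r + ‖b‖ + R := by
    rw [hpu]
    exact (norm_add_le _ _).trans (add_le_add ((norm_sub_le _ _).trans (by gcongr)) (hR k hk))
  have hB0 : 0 ≤ B := by
    obtain ⟨q₁, hq₁, -⟩ := hQ hz
    exact (norm_nonneg q₁).trans (hB q₁ hq₁)
  have hpz : ⟪p, z.2⟫_ℝ ≤ (r + ‖b‖ + R) * B :=
    (inner_le_of_mem_polar_of_mem_add hB hp (hQ hz)).trans (by gcongr)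
  have hlag := (neg_lagrangian_le_cut hconv (hf z.1) k).trans (cut_le_of_mem_cconv hcut hk)
  have hfk : f k ≤ F := hF ⟨k, hk, rfl⟩
  have hu' : ⟪u, z.2⟫_ℝ = ⟪p, z.2⟫_ℝ - ⟪A k - b, z.2⟫_ℝ := by
    rw [hpu, ← inner_sub_left]
    congr 1
    abel
  rw [lagrangian] at hlag
  linarith

end CutDuality

/-! ### Invariants of an execution -/

section Run

variable {E₁ E₂ : Type*} [NormedAddCommGroup E₁] [InnerProductSpace ℝ E₁] [MeasurableSpace E₁]
  [NormedAddCommGroup E₂] [InnerProductSpace ℝ E₂]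

namespace Trace

/-- The pair `(w₁^t, μ₂^t)`, which determines the dual candidate since `μ₁^t = ∇f(w₁^t)`. -/
def dualPt (T : Trace E₁ E₂) (t : ℕ) : E₁ × E₂ := (T.w t, (T.μ t).snd)

/-- The test `Δ^t < (1 - λ) Δ̄` that triggers a pruning at iteration `t`. -/
def Prunes (T : Trace E₁ E₂) (f : E₁ → ℝ) (A : E₁ →L[ℝ] E₂) (b : E₂) (Q : Set E₂) (lam : ℝ)
    (t : ℕ) : Prop :=
  T.Δ f A b Q t < ((1 - lam : ℝ) : EReal) * T.ΔbarBefore t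

/-- The gap `Δ^t` as a real number. Its two terms are finite under the assumptions of
`IsRun.Δ_eq_gap`. -/
def gap (T : Trace E₁ E₂) (f : E₁ → ℝ) (A : E₁ →L[ℝ] E₂) (b : E₂) (Q : Set E₂) (t : ℕ) : ℝ :=
  (T.hbar t).toReal + (cost f A b Q (T.xhat t)).toReal

/-- The value of `Δ̄` at the end of iteration `t`, as a real number. -/
def gapRef (T : Trace E₁ E₂) (t : ℕ) : ℝ := (T.ΔbarBefore (t + 1)).toReal

end Trace

namespace IsRun

variable [CompleteSpace E₁] [CompleteSpace E₂] {f : E₁ → ℝ} {A : E₁ →L[ℝ] E₂} {b : E₂}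
  {Q : Set E₂} {K Kinit C : Set E₁} {lam : ℝ} {T : Trace E₁ E₂}

theorem Kcut_subset_Ktilde (h : IsRun f A b Q K Kinit lam T) (t : ℕ) :
    T.Kcut t ⊆ T.Ktilde t := by
  by_cases hp : T.Prunes f A b Q lam t
  · exact (h.prune t hp).1
  · rw [(h.no_prune t hp).1]
    exact subset_cconv _

theorem isSimpleSet_KBefore (h : IsRun f A b Q K Kinit lam T) (t : ℕ) :
    IsSimpleSet Kinit (T.KBefore t) := by
  induction t with
  | zero => exact ⟨∅, finite_empty, by rw [h.init_K, union_empty]⟩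
  | succ t ih =>
    by_cases hp : T.Prunes f A b Q lam t
    · exact (h.prune t hp).2.1
    · obtain ⟨S, hS, hKS⟩ := ih
      refine ⟨S ∪ {-T.v t}, hS.union (finite_singleton _), ?_⟩
      rw [← union_assoc, ← hKS]
      exact (h.no_prune t hp).1

theorem Kinit_subset_KBefore (h : IsRun f A b Q K Kinit lam T) (t : ℕ) :
    Kinit ⊆ T.KBefore t := by
  obtain ⟨S, -, hS⟩ := h.isSimpleSet_KBefore t
  exact hS ▸ subset_union_left

theorem isCompact_KBefore (h : IsRun f A b Q K Kinit lam T) (hKinit : IsCompact Kinit) (t : ℕ) :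
    IsCompact (T.KBefore t) := by
  obtain ⟨S, hS, hKS⟩ := h.isSimpleSet_KBefore t
  exact hKS ▸ hKinit.union hS.isCompact

theorem isCompact_Ktilde (h : IsRun f A b Q K Kinit lam T) (hKinit : IsCompact Kinit) (t : ℕ) :
    IsCompact (T.Ktilde t) :=
  isCompact_cconv ((h.isCompact_KBefore hKinit t).union isCompact_singleton)

theorem isSolution_liftedCost_iff (h : IsRun f A b Q K Kinit lam T) (t : ℕ)
    (x : WithLp 2 (E₁ × E₂)) :
    (IsSolution (liftedCost f b Q) (-T.Etilde A t) x ∧ x.fst = T.xhat t) ↔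
      (x.fst = T.xhat t ∧ x.snd = A (T.xhat t)) := by
  rw [T.neg_Etilde, isSolution_liftedCost_graphOver_iff]
  constructor
  · rintro ⟨⟨-, hsnd⟩, hfst⟩
    exact ⟨hfst, hfst ▸ hsnd⟩
  · rintro ⟨hfst, hsnd⟩
    rw [hfst]
    exact ⟨⟨h.xhat_sol t, hsnd⟩, rfl⟩

theorem Ktilde_subset (h : IsRun f A b Q K Kinit lam T) (hC : IsClosed C) (hC' : Convex ℝ C)
    (hKinit : Kinit ⊆ C) (hv : ∀ t, -T.v t ∈ C) (t : ℕ) : T.Ktilde t ⊆ C := by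
  have hstep (t : ℕ) (ht : T.KBefore t ⊆ C) : T.Ktilde t ⊆ C :=
    cconv_subset hC hC' (union_subset ht (singleton_subset_iff.2 (hv t)))
  have hbefore : T.KBefore t ⊆ C := by
    induction t with
    | zero => rwa [h.init_K]
    | succ t ih => exact (h.Kcut_subset_Ktilde t).trans (hstep t ih)
  exact hstep t hbefore

theorem xhat_mem_Ktilde_succ (h : IsRun f A b Q K Kinit lam T) (t : ℕ) :
    T.xhat t ∈ T.Ktilde (t + 1) := by
  have hcut : T.xhat t ∈ cconv (T.Kcut t) := by
    by_cases hp : T.Prunes f A b Q lam t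
    · exact (h.prune t hp).2.2.1
    · rw [(h.no_prune t hp).1]
      exact (h.xhat_sol t).1
  exact cconv_mono subset_union_left hcut

theorem norm_w_le (h : IsRun f A b Q K Kinit lam T) {R : ℝ}
    (hK : ∀ t, T.Kcut t ⊆ Metric.closedBall 0 R) (hw : ‖T.w 0‖ ≤ R) (t : ℕ) : ‖T.w t‖ ≤ R := by
  induction t with
  | zero => exact hw
  | succ t ih =>
    have hmass : 0 ≤ mass (T.n t) := mass_nonneg _
    have hmean : ‖mean (T.n t)‖ ≤ R * mass (T.n t) :=
      norm_mean_le (fun v hv => by simpa using hK t hv) (h.n_sol t).1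
    rw [h.w_next, norm_smul, norm_inv, Real.norm_of_nonneg (by linarith),
      inv_mul_le_iff₀ (by linarith)]
    linarith [norm_add_le (T.w t) (mean (T.n t))]

theorem μ₁_eq_gradient (h : IsRun f A b Q K Kinit lam T) (hconv : ConvexOn ℝ univ f)
    (hf : Differentiable ℝ f) (t : ℕ) : (T.μ t).fst = gradient f (T.w t) := by
  cases t with
  | zero => exact eq_gradient_of_mem_subdiff_conj hconv (hf _) h.init_w
  | succ t => exact h.μ₁_next t

theorem μ₂_mem (h : IsRun f A b Q K Kinit lam T) (t : ℕ) : (T.μ t).snd ∈ Q := by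
  cases t with
  | zero => exact h.init_μ₂
  | succ t => exact (h.μ₂_next t).1

theorem dualCost_μ (h : IsRun f A b Q K Kinit lam T) (hconv : ConvexOn ℝ univ f)
    (hf : Differentiable ℝ f) (t : ℕ) :
    dualCost f A b Q K (T.μ t) = cut f A b (T.dualPt t) (-T.v t) :=
  dualCost_eq_cut hconv (hf _) (h.μ₁_eq_gradient hconv hf t) (h.μ₂_mem t) (h.oracle t)

theorem hbar_eq_min (h : IsRun f A b Q K Kinit lam T) (hconv : ConvexOn ℝ univ f)
    (hf : Differentiable ℝ f) (t : ℕ) :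
    T.hbar t = min (T.hbarBefore t) (dualCost f A b Q K (T.μ t)) := by
  rw [h.hbar_eq, h.dualCost_μ hconv hf, h.μ₁_eq_gradient hconv hf]
  congr 2
  rw [Trace.dualPt, cut, inner_add_left, A.adjoint_inner_left, map_neg, sub_neg_eq_add,
    sub_neg_eq_add, inner_add_right, inner_add_right]
  ring

theorem exists_μhat_eq (h : IsRun f A b Q K Kinit lam T) (t : ℕ) : ∃ s, T.μhat t = T.μ s := by
  induction t with
  | zero =>
    by_cases hlt : T.hbar 0 < T.hbarBefore 0
    · exact ⟨0, h.μhat_new 0 hlt⟩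
    · exact ⟨0, (h.μhat_old 0 hlt).trans h.init_μhat⟩
  | succ t ih =>
    by_cases hlt : T.hbar (t + 1) < T.hbarBefore (t + 1)
    · exact ⟨t + 1, h.μhat_new _ hlt⟩
    · exact ih.imp fun s hs => (h.μhat_old _ hlt).trans hs

theorem dualCost_μhat (h : IsRun f A b Q K Kinit lam T) (hconv : ConvexOn ℝ univ f)
    (hf : Differentiable ℝ f) (t : ℕ) : dualCost f A b Q K (T.μhat t) = T.hbar t := by
  have hnew (t : ℕ) (hlt : T.hbar t < T.hbarBefore t) :
      dualCost f A b Q K (T.μhat t) = T.hbar t := by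
    rw [h.μhat_new t hlt]
    rw [h.hbar_eq_min hconv hf] at hlt ⊢
    exact (min_eq_right (min_lt_iff.1 hlt |>.resolve_left (lt_irrefl _)).le).symm
  induction t with
  | zero =>
    refine hnew 0 ?_
    rw [h.hbar_eq_min hconv hf, h.init_hbar, top_inf_eq, h.dualCost_μ hconv hf]
    exact EReal.coe_lt_top _
  | succ t ih =>
    by_cases hlt : T.hbar (t + 1) < T.hbarBefore (t + 1)
    · exact hnew _ hlt
    · have hle : T.hbar (t + 1) ≤ T.hbarBefore (t + 1) := by
        rw [h.hbar_eq_min hconv hf]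
        exact min_le_left _ _
      rw [h.μhat_old _ hlt, hle.eq_of_not_lt hlt]
      exact ih

theorem coe_toReal_hbar (h : IsRun f A b Q K Kinit lam T) (hconv : ConvexOn ℝ univ f)
    (hf : Differentiable ℝ f) (t : ℕ) : ((T.hbar t).toReal : EReal) = T.hbar t := by
  obtain ⟨s, hs⟩ := h.exists_μhat_eq t
  rw [← h.dualCost_μhat hconv hf, hs, h.dualCost_μ hconv hf, EReal.toReal_coe]

theorem neg_hbar_le_cost (h : IsRun f A b Q K Kinit lam T) (hconv : ConvexOn ℝ univ f)
    (hf : Differentiable ℝ f) (t : ℕ) {x : E₁} (hx : x ∈ K) : -T.hbar t ≤ cost f A b Q x := by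
  obtain ⟨s, hs⟩ := h.exists_μhat_eq t
  rw [← h.dualCost_μhat hconv hf]
  exact neg_dualCost_le_cost (hs ▸ h.μ₂_mem s) hx

theorem coe_toReal_cost_xhat (h : IsRun f A b Q K Kinit lam T)
    (hcost : ∃ x ∈ cconv Kinit, cost f A b Q x ≠ ⊤) (t : ℕ) :
    ((cost f A b Q (T.xhat t)).toReal : EReal) = cost f A b Q (T.xhat t) := by
  obtain ⟨x, hx, hx'⟩ := hcost
  refine EReal.coe_toReal (ne_top_of_le_ne_top hx' ((h.xhat_sol t).2 x ?_))
    (ne_bot_of_le_ne_bot (EReal.coe_ne_bot _) (lagrangian_le_cost (h.μ₂_mem 0)))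
  exact cconv_mono ((h.Kinit_subset_KBefore t).trans subset_union_left) hx

theorem Δ_eq_gap (h : IsRun f A b Q K Kinit lam T) (hconv : ConvexOn ℝ univ f)
    (hf : Differentiable ℝ f) (hcost : ∃ x ∈ cconv Kinit, cost f A b Q x ≠ ⊤) (t : ℕ) :
    T.Δ f A b Q t = T.gap f A b Q t := by
  rw [Trace.gap, EReal.coe_add, h.coe_toReal_hbar hconv hf, h.coe_toReal_cost_xhat hcost, Trace.Δ,
    Trace.hunder, sub_eq_add_neg, neg_neg]

theorem level_eq (h : IsRun f A b Q K Kinit lam T) (hconv : ConvexOn ℝ univ f)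
    (hf : Differentiable ℝ f) (hcost : ∃ x ∈ cconv Kinit, cost f A b Q x ≠ ⊤) (t : ℕ) :
    T.level f A b Q lam t = ((T.hbar t).toReal - (1 - lam) * T.gap f A b Q t : ℝ) := by
  rw [Trace.level, Trace.hunder, ← h.coe_toReal_cost_xhat hcost, ← h.coe_toReal_hbar hconv hf,
    ← EReal.coe_neg, ← EReal.coe_mul, ← EReal.coe_mul, ← EReal.coe_add, EReal.toReal_coe, Trace.gap]
  congr 1
  ring

theorem isProjStep (h : IsRun f A b Q K Kinit lam T) (hconv : ConvexOn ℝ univ f)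
    (hf : Differentiable ℝ f) (hcost : ∃ x ∈ cconv Kinit, cost f A b Q x ≠ ⊤) (t : ℕ) :
    IsProjStep f A b Q (T.Kcut t) ((T.hbar t).toReal - (1 - lam) * T.gap f A b Q t)
      (T.dualPt t) (T.n t) (T.dualPt (t + 1)) where
  isSolution := h.level_eq hconv hf hcost t ▸ h.n_sol t
  fst_eq := h.w_next t
  snd_proj := h.μ₂_next t

theorem antitone_toReal_hbar (h : IsRun f A b Q K Kinit lam T) (hconv : ConvexOn ℝ univ f)
    (hf : Differentiable ℝ f) : Antitone fun t => (T.hbar t).toReal := by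
  refine antitone_nat_of_succ_le fun t => ?_
  rw [← EReal.coe_le_coe_iff, h.coe_toReal_hbar hconv hf, h.coe_toReal_hbar hconv hf,
    h.hbar_eq_min hconv hf (t + 1)]
  exact min_le_left _ _

theorem toReal_hbar_le_cut (h : IsRun f A b Q K Kinit lam T) (hconv : ConvexOn ℝ univ f)
    (hf : Differentiable ℝ f) (t : ℕ) : (T.hbar t).toReal ≤ cut f A b (T.dualPt t) (-T.v t) := by
  rw [← EReal.coe_le_coe_iff, h.coe_toReal_hbar hconv hf, h.hbar_eq_min hconv hf,
    ← h.dualCost_μ hconv hf]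
  exact min_le_right _ _

theorem antitone_gap (h : IsRun f A b Q K Kinit lam T) (hconv : ConvexOn ℝ univ f)
    (hf : Differentiable ℝ f) (hcost : ∃ x ∈ cconv Kinit, cost f A b Q x ≠ ⊤) :
    Antitone (T.gap f A b Q) := by
  refine antitone_nat_of_succ_le fun t =>
    add_le_add (h.antitone_toReal_hbar hconv hf t.le_succ) ?_
  rw [← EReal.coe_le_coe_iff, h.coe_toReal_cost_xhat hcost, h.coe_toReal_cost_xhat hcost]
  exact (h.xhat_sol (t + 1)).2 _ (h.xhat_mem_Ktilde_succ t)

theorem exists_value_eq (h : IsRun f A b Q K Kinit lam T) (hconv : ConvexOn ℝ univ f)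
    (hf : Differentiable ℝ f) (hcost : ∃ x ∈ cconv Kinit, cost f A b Q x ≠ ⊤)
    (hK : ∀ t, T.xhat t ∈ K) :
    ∃ V : ℝ, value f A b Q K = V ∧
      ∀ t, V ≤ (cost f A b Q (T.xhat t)).toReal ∧ -V ≤ (T.hbar t).toReal := by
  have hle (t : ℕ) : value f A b Q K ≤ (cost f A b Q (T.xhat t)).toReal := by
    refine (iInf_le _ (T.xhat t)).trans ?_
    rw [h.coe_toReal_cost_xhat hcost, indic, if_pos (hK t), add_zero]
  have hge (t : ℕ) : ((-(T.hbar t).toReal : ℝ) : EReal) ≤ value f A b Q K := by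
    refine le_iInf fun x => ?_
    by_cases hx : x ∈ K
    · rw [indic, if_pos hx, add_zero, EReal.coe_neg, h.coe_toReal_hbar hconv hf]
      exact h.neg_hbar_le_cost hconv hf t hx
    · rw [indic, if_neg hx, EReal.add_top_of_ne_bot
        (ne_bot_of_le_ne_bot (EReal.coe_ne_bot _) (lagrangian_le_cost (h.μ₂_mem 0)))]
      exact le_top
  have hV : ((value f A b Q K).toReal : EReal) = value f A b Q K :=
    EReal.coe_toReal (ne_top_of_le_ne_top (EReal.coe_ne_top _) (hle 0))
      (ne_bot_of_le_ne_bot (EReal.coe_ne_bot _) (hge 0))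
  refine ⟨_, hV.symm, fun t => ⟨?_, ?_⟩⟩
  · rw [← EReal.coe_le_coe_iff, hV]
    exact hle t
  · rw [neg_le, ← EReal.coe_le_coe_iff, hV]
    exact hge t

theorem gap_nonneg (h : IsRun f A b Q K Kinit lam T) (hconv : ConvexOn ℝ univ f)
    (hf : Differentiable ℝ f) (hcost : ∃ x ∈ cconv Kinit, cost f A b Q x ≠ ⊤)
    {t : ℕ} (hK : T.xhat t ∈ K) : 0 ≤ T.gap f A b Q t := by
  have hdual := h.neg_hbar_le_cost hconv hf t hK
  rw [← h.coe_toReal_hbar hconv hf, ← h.coe_toReal_cost_xhat hcost, ← EReal.coe_neg,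
    EReal.coe_le_coe_iff, neg_le_iff_add_nonneg'] at hdual
  exact hdual

/-! ### Phases between two prunings -/

theorem prunes_zero (h : IsRun f A b Q K Kinit lam T) (hlam : lam < 1)
    (hΔ : ∀ t, T.Δ f A b Q t = T.gap f A b Q t) : T.Prunes f A b Q lam 0 := by
  rw [Trace.Prunes, h.init_Δbar, EReal.coe_mul_top_of_pos (sub_pos.2 hlam), hΔ]
  exact EReal.coe_lt_top _

theorem gapRef_of_prunes (h : IsRun f A b Q K Kinit lam T)
    (hΔ : ∀ t, T.Δ f A b Q t = T.gap f A b Q t) {t : ℕ} (ht : T.Prunes f A b Q lam t) :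
    T.gapRef t = T.gap f A b Q t := by
  rw [Trace.gapRef, (h.prune t ht).2.2.2, hΔ, EReal.toReal_coe]

theorem gapRef_succ_of_not_prunes (h : IsRun f A b Q K Kinit lam T) {t : ℕ}
    (ht : ¬ T.Prunes f A b Q lam (t + 1)) : T.gapRef (t + 1) = T.gapRef t := by
  rw [Trace.gapRef, (h.no_prune _ ht).2, Trace.gapRef]

theorem coe_gapRef (h : IsRun f A b Q K Kinit lam T) (hlam : lam < 1)
    (hΔ : ∀ t, T.Δ f A b Q t = T.gap f A b Q t) (t : ℕ) :
    (T.gapRef t : EReal) = T.ΔbarBefore (t + 1) := by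
  have hprunes {t : ℕ} (ht : T.Prunes f A b Q lam t) :
      (T.gapRef t : EReal) = T.ΔbarBefore (t + 1) := by
    rw [h.gapRef_of_prunes hΔ ht, (h.prune t ht).2.2.2, hΔ]
  induction t with
  | zero => exact hprunes (h.prunes_zero hlam hΔ)
  | succ t ih =>
    by_cases ht : T.Prunes f A b Q lam (t + 1)
    · exact hprunes ht
    · rw [h.gapRef_succ_of_not_prunes ht, (h.no_prune _ ht).2, ih]

theorem prunes_succ_iff (h : IsRun f A b Q K Kinit lam T) (hlam : lam < 1)
    (hΔ : ∀ t, T.Δ f A b Q t = T.gap f A b Q t) (t : ℕ) :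
    T.Prunes f A b Q lam (t + 1) ↔ T.gap f A b Q (t + 1) < (1 - lam) * T.gapRef t := by
  rw [Trace.Prunes, hΔ, ← h.coe_gapRef hlam hΔ, ← EReal.coe_mul, EReal.coe_lt_coe_iff]

theorem gap_le_gapRef (h : IsRun f A b Q K Kinit lam T) (hlam : lam < 1)
    (hΔ : ∀ t, T.Δ f A b Q t = T.gap f A b Q t) (hgap : Antitone (T.gap f A b Q)) (t : ℕ) :
    T.gap f A b Q t ≤ T.gapRef t := by
  induction t with
  | zero => exact (h.gapRef_of_prunes hΔ (h.prunes_zero hlam hΔ)).ge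
  | succ t ih =>
    by_cases ht : T.Prunes f A b Q lam (t + 1)
    · exact (h.gapRef_of_prunes hΔ ht).ge
    · rw [h.gapRef_succ_of_not_prunes ht]
      exact (hgap t.le_succ).trans ih

theorem gapRef_succ_le_of_prunes (h : IsRun f A b Q K Kinit lam T) (hlam : lam < 1)
    (hΔ : ∀ t, T.Δ f A b Q t = T.gap f A b Q t) {t : ℕ} (ht : T.Prunes f A b Q lam (t + 1)) :
    T.gapRef (t + 1) ≤ (1 - lam) * T.gapRef t := by
  rw [h.gapRef_of_prunes hΔ ht]
  exact ((h.prunes_succ_iff hlam hΔ t).1 ht).le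

theorem gapRef_eq_of_forall_not_prunes (h : IsRun f A b Q K Kinit lam T) {s t : ℕ} (hst : s ≤ t)
    (hp : ∀ j ∈ Ioc s t, ¬ T.Prunes f A b Q lam j) : T.gapRef t = T.gapRef s := by
  induction t, hst using Nat.le_induction with
  | base => rfl
  | succ t hst ih =>
    rw [h.gapRef_succ_of_not_prunes (hp _ ⟨by lia, le_rfl⟩),
      ih fun j hj => hp j ⟨hj.1, hj.2.trans t.le_succ⟩]

theorem Kcut_subset_of_forall_not_prunes (h : IsRun f A b Q K Kinit lam T) {s t : ℕ} (hst : s ≤ t)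
    (hp : ∀ j ∈ Ioc s t, ¬ T.Prunes f A b Q lam j) : T.Kcut s ⊆ T.Kcut t := by
  induction t, hst using Nat.le_induction with
  | base => rfl
  | succ t hst ih =>
    refine (ih fun j hj => hp j ⟨hj.1, hj.2.trans t.le_succ⟩).trans ?_
    rw [(h.no_prune _ (hp (t + 1) ⟨by lia, le_rfl⟩)).1]
    exact subset_union_left

theorem mul_gapRef_le_gap (h : IsRun f A b Q K Kinit lam T) (hlam : lam < 1)
    (hΔ : ∀ t, T.Δ f A b Q t = T.gap f A b Q t) {t : ℕ} (ht : ¬ T.Prunes f A b Q lam t) :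
    (1 - lam) * T.gapRef t ≤ T.gap f A b Q t := by
  cases t with
  | zero => exact absurd (h.prunes_zero hlam hΔ) ht
  | succ t =>
    rw [h.gapRef_succ_of_not_prunes ht]
    exact not_lt.1 (mt (h.prunes_succ_iff hlam hΔ t).2 ht)

end IsRun

end Run

/-! ### Convergence rate -/

section Rate

/-- Bounding the previous phases by induction, at their last index, sums the geometric series of
their contributions. -/
theorem mul_sq_le_of_phases {ref : ℕ → ℝ} {p : ℕ → Prop} {a B : ℝ} (hnonneg : ∀ t, 0 ≤ ref t)
    (hanti : Antitone ref) (ha : a ∈ Ico (0 : ℝ) 1)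
    (hp : ∀ t, p (t + 1) → ref (t + 1) ≤ a * ref t)
    (hB : ∀ s t, s ≤ t → (∀ j ∈ Ioc s t, ¬ p j) → ((t : ℝ) - s) * ref t ^ 2 ≤ B) (t : ℕ) :
    t * ref t ^ 2 ≤ (B + ref 0 ^ 2) / (1 - a ^ 2) := by
  classical
  have hsq (t : ℕ) : ref t ^ 2 ≤ ref 0 ^ 2 := pow_le_pow_left₀ (hnonneg t) (hanti t.zero_le) 2
  have ha2 : 0 < 1 - a ^ 2 := by nlinarith [ha.1, ha.2]
  induction t using Nat.strong_induction_on with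
  | _ t ih =>
  rw [le_div_iff₀ ha2]
  have hphase := hB _ t (Nat.findGreatest_le (P := p) t) fun j hj hpj =>
    Nat.findGreatest_is_greatest hj.1 hj.2 hpj
  rcases hs : Nat.findGreatest p t with _ | s
  · rw [hs, Nat.cast_zero, sub_zero] at hphase
    have : 0 ≤ t * ref t ^ 2 := by positivity
    nlinarith [sq_nonneg (ref 0), sq_nonneg a]
  · have hst : s < t := Nat.succ_le_iff.1 (hs.symm.trans_le (Nat.findGreatest_le t))
    have hdrop : ref (s + 1) ^ 2 ≤ a ^ 2 * ref s ^ 2 := by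
      rw [← mul_pow]
      exact pow_le_pow_left₀ (hnonneg _) (hp s (Nat.findGreatest_of_ne_zero hs s.succ_ne_zero)) 2
    have hprev := ih s hst
    rw [le_div_iff₀ ha2] at hprev
    have hmono : ref t ^ 2 ≤ ref (s + 1) ^ 2 := pow_le_pow_left₀ (hnonneg t) (hanti hst) 2
    rw [hs] at hphase
    push_cast at hphase
    calc t * ref t ^ 2 * (1 - a ^ 2)
        = ((t - (s + 1)) * ref t ^ 2 + (s + 1) * ref t ^ 2) * (1 - a ^ 2) := by ring
      _ ≤ (B + (s * (a ^ 2 * ref s ^ 2) + ref 0 ^ 2)) * (1 - a ^ 2) := by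
          gcongr
          calc (s + 1) * ref t ^ 2 ≤ s * ref (s + 1) ^ 2 + ref 0 ^ 2 := by
                rw [add_one_mul]
                exact add_le_add (mul_le_mul_of_nonneg_left hmono s.cast_nonneg) (hsq t)
            _ ≤ s * (a ^ 2 * ref s ^ 2) + ref 0 ^ 2 := by gcongr
      _ = a ^ 2 * (s * ref s ^ 2 * (1 - a ^ 2)) + (1 - a ^ 2) * (B + ref 0 ^ 2) := by ring
      _ ≤ a ^ 2 * (B + ref 0 ^ 2) + (1 - a ^ 2) * (B + ref 0 ^ 2) := by gcongr
      _ = B + ref 0 ^ 2 := by ring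

variable {E₁ E₂ : Type*} [NormedAddCommGroup E₁] [InnerProductSpace ℝ E₁] [CompleteSpace E₁]
  [MeasurableSpace E₁] [NormedAddCommGroup E₂] [InnerProductSpace ℝ E₂] [CompleteSpace E₂]

/-- The assumptions on the data of the problem and on the execution `T` under which the method
converges. The points of `K` in use and the iterates `w₁^t` lie in the ball of radius `R`. -/
structure IsBoundedRun (f : E₁ → ℝ) (β : ℝ≥0) (A : E₁ →L[ℝ] E₂) (b : E₂) (Q : Set E₂)
    (K Kinit : Set E₁) (lam : ℝ) (T : Trace E₁ E₂) (R : ℝ) : Prop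
    extends IsRun f A b Q K Kinit lam T where
  convexOn : ConvexOn ℝ univ f
  differentiable : Differentiable ℝ f
  lipschitz : LipschitzWith β (gradient f)
  convex_Q : Convex ℝ Q
  isClosed_K : IsClosed K
  convex_K : Convex ℝ K
  isCompact_Kinit : IsCompact Kinit
  Kinit_subset : Kinit ⊆ K
  qualification : ∃ Q₁ Q₂ : Set E₂, Q ⊆ Q₁ + Q₂ ∧ Bornology.IsBounded Q₁ ∧
    -b ∈ interior (polar Q₂ - A '' cconv Kinit)
  lam_mem : lam ∈ Ioo 0 1
  norm_le_of_mem_Kinit : ∀ x ∈ Kinit, ‖x‖ ≤ R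
  norm_v_le : ∀ t, ‖T.v t‖ ≤ R
  norm_w_zero_le : ‖T.w 0‖ ≤ R

namespace IsBoundedRun

variable {f : E₁ → ℝ} {β : ℝ≥0} {A : E₁ →L[ℝ] E₂} {b : E₂} {Q : Set E₂} {K Kinit : Set E₁}
  {lam : ℝ} {T : Trace E₁ E₂} {R : ℝ}

theorem exists_cost_ne_top (h : IsBoundedRun f β A b Q K Kinit lam T R) :
    ∃ x ∈ cconv Kinit, cost f A b Q x ≠ ⊤ := by
  obtain ⟨Q₁, Q₂, hQ, hQ₁, hqualif⟩ := h.qualification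
  exact DLS.exists_cost_ne_top hQ hQ₁ (interior_subset hqualif)

theorem xhat_mem (h : IsBoundedRun f β A b Q K Kinit lam T R) (t : ℕ) : T.xhat t ∈ K :=
  h.Ktilde_subset h.isClosed_K h.convex_K h.Kinit_subset (fun s => (h.oracle s).1) t
    (h.xhat_sol t).1

theorem norm_le_of_mem_Ktilde (h : IsBoundedRun f β A b Q K Kinit lam T R) {t : ℕ} {x : E₁}
    (hx : x ∈ T.Ktilde t) : ‖x‖ ≤ R := by
  rw [← mem_closedBall_zero_iff]
  exact h.Ktilde_subset Metric.isClosed_closedBall (convex_closedBall 0 R)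
    (fun x hx => mem_closedBall_zero_iff.2 (h.norm_le_of_mem_Kinit x hx))
    (fun s => mem_closedBall_zero_iff.2 ((norm_neg _).trans_le (h.norm_v_le s))) t hx

theorem norm_w_le (h : IsBoundedRun f β A b Q K Kinit lam T R) (t : ℕ) : ‖T.w t‖ ≤ R :=
  h.toIsRun.norm_w_le (fun s _ hx => mem_closedBall_zero_iff.2
    (h.norm_le_of_mem_Ktilde (h.Kcut_subset_Ktilde s hx))) h.norm_w_zero_le t

theorem Δ_eq_gap (h : IsBoundedRun f β A b Q K Kinit lam T R) (t : ℕ) :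
    T.Δ f A b Q t = T.gap f A b Q t :=
  h.toIsRun.Δ_eq_gap h.convexOn h.differentiable h.exists_cost_ne_top t

theorem gap_nonneg (h : IsBoundedRun f β A b Q K Kinit lam T R) (t : ℕ) : 0 ≤ T.gap f A b Q t :=
  h.toIsRun.gap_nonneg h.convexOn h.differentiable h.exists_cost_ne_top (h.xhat_mem t)

theorem Δ_eq_cost_add_dualCost (h : IsBoundedRun f β A b Q K Kinit lam T R) (t : ℕ) :
    T.Δ f A b Q t =
      (cost f A b Q (T.xhat t) + indic K (T.xhat t)) + dualCost f A b Q K (T.μhat t) := by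
  rw [indic, if_pos (h.xhat_mem t), add_zero, h.dualCost_μhat h.convexOn h.differentiable, Trace.Δ,
    Trace.hunder, sub_eq_add_neg, neg_neg, add_comm]

theorem antitone_gap (h : IsBoundedRun f β A b Q K Kinit lam T R) : Antitone (T.gap f A b Q) :=
  h.toIsRun.antitone_gap h.convexOn h.differentiable h.exists_cost_ne_top

theorem gap_le_gapRef (h : IsBoundedRun f β A b Q K Kinit lam T R) (t : ℕ) :
    T.gap f A b Q t ≤ T.gapRef t :=
  h.toIsRun.gap_le_gapRef h.lam_mem.2 h.Δ_eq_gap h.antitone_gap t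

theorem isCompact_Kcut (h : IsBoundedRun f β A b Q K Kinit lam T R) (t : ℕ) :
    IsCompact (T.Kcut t) :=
  h.isCompact_KBefore h.isCompact_Kinit (t + 1)

theorem gapRef_nonneg (h : IsBoundedRun f β A b Q K Kinit lam T R) (t : ℕ) : 0 ≤ T.gapRef t :=
  (h.gap_nonneg t).trans (h.gap_le_gapRef t)

theorem antitone_gapRef (h : IsBoundedRun f β A b Q K Kinit lam T R) : Antitone T.gapRef := by
  refine antitone_nat_of_succ_le fun t => ?_
  by_cases ht : T.Prunes f A b Q lam (t + 1)
  · refine (h.gapRef_succ_le_of_prunes h.lam_mem.2 h.Δ_eq_gap ht).trans ?_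
    exact mul_le_of_le_one_left (h.gapRef_nonneg t) (sub_le_self 1 h.lam_mem.1.le)
  · exact (h.gapRef_succ_of_not_prunes ht).le

theorem exists_cut_le (h : IsBoundedRun f β A b Q K Kinit lam T R) (t : ℕ) {ε : ℝ} (hε : 0 < ε) :
    ∃ y ∈ T.Ktilde t, ∃ q ∈ Q, ∀ x ∈ T.Ktilde t,
      cut f A b (y, q) x ≤ ε - (cost f A b Q (T.xhat t)).toReal := by
  have hlt : ∀ x ∈ T.Ktilde t,
      (((cost f A b Q (T.xhat t)).toReal - ε : ℝ) : EReal) < cost f A b Q x := fun x hx => by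
    refine lt_of_lt_of_le ?_ ((h.xhat_sol t).2 x hx)
    rw [← h.coe_toReal_cost_xhat h.exists_cost_ne_top, EReal.coe_lt_coe_iff]
    exact sub_lt_self _ hε
  simpa only [neg_sub] using exists_forall_cut_le h.convexOn h.differentiable h.convex_Q
    (h.isCompact_Ktilde h.isCompact_Kinit t) (convex_cconv _) ⟨_, (h.xhat_sol t).1⟩ hlt

/-- The gap is the sum of the primal and the dual suboptimality, and both are nonnegative by weak
duality. -/
theorem suboptimality_bounds (h : IsBoundedRun f β A b Q K Kinit lam T R) {t : ℕ} {c : ℝ}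
    (hc : T.gap f A b Q t ≤ c) :
    (0 ≤ T.Δ f A b Q t ∧ T.Δ f A b Q t ≤ c) ∧
      (0 ≤ cost f A b Q (T.xhat t) - value f A b Q K ∧
        cost f A b Q (T.xhat t) - value f A b Q K ≤ c) ∧
      (0 ≤ dualCost f A b Q K (T.μhat t) + value f A b Q K ∧
        dualCost f A b Q K (T.μhat t) + value f A b Q K ≤ c) := by
  have hconv := h.convexOn
  have hf := h.differentiable
  obtain ⟨V, hV, hVt⟩ := h.exists_value_eq hconv hf h.exists_cost_ne_top h.xhat_mem
  obtain ⟨hprimal, hdual⟩ := hVt t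
  rw [h.Δ_eq_gap, h.dualCost_μhat hconv hf, hV, ← h.coe_toReal_cost_xhat h.exists_cost_ne_top,
    ← h.coe_toReal_hbar hconv hf, ← EReal.coe_sub, ← EReal.coe_add, ← EReal.coe_zero]
  simp only [EReal.coe_le_coe_iff]
  have hnonneg := h.gap_nonneg t
  rw [Trace.gap] at hc hnonneg ⊢
  refine ⟨⟨hnonneg, hc⟩, ⟨?_, ?_⟩, ?_, ?_⟩ <;> linarith

variable [BorelSpace E₁]

theorem cut_dualPt_succ_le (h : IsBoundedRun f β A b Q K Kinit lam T R) {t : ℕ} {k : E₁}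
    (hk : k ∈ T.Kcut t) :
    cut f A b (T.dualPt (t + 1)) k ≤ (T.hbar t).toReal - (1 - lam) * T.gap f A b Q t :=
  (h.isProjStep h.convexOn h.differentiable h.exists_cost_ne_top t).cut_le_level
    (h.differentiable _) h.convex_Q (h.isCompact_Kcut t) hk

/-- The oracle has cut off the current dual point: along `-v₁^t` the value decreases from at least
`h̄^t` to at most the level. -/
theorem sq_mul_gap_le_diverg (h : IsBoundedRun f β A b Q K Kinit lam T R) {t : ℕ}
    (hv : -T.v t ∈ T.Kcut t) :
    ((1 - lam) * T.gap f A b Q t) ^ 2 ≤ 4 * (β * (2 * R) ^ 2 + (‖b‖ + ‖A‖ * R) ^ 2) *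
      diverg f (T.dualPt t) (T.dualPt (t + 1)) := by
  have hgap : 0 ≤ (1 - lam) * T.gap f A b Q t :=
    mul_nonneg (sub_nonneg.2 h.lam_mem.2.le) (h.gap_nonneg t)
  have hlow := h.toReal_hbar_le_cut h.convexOn h.differentiable t
  have hupp := h.cut_dualPt_succ_le hv
  have hnorm : ‖T.w t - -T.v t‖ ≤ 2 * R := by
    rw [sub_neg_eq_add, two_mul]
    exact norm_add_le_of_le (h.norm_w_le t) (h.norm_v_le t)
  have hnorm' : ‖b - A (-T.v t)‖ ≤ ‖b‖ + ‖A‖ * R := by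
    rw [map_neg, sub_neg_eq_add]
    exact norm_add_le_of_le le_rfl (A.le_opNorm_of_le (h.norm_v_le t))
  calc ((1 - lam) * T.gap f A b Q t) ^ 2
      ≤ (cut f A b (T.dualPt t) (-T.v t) - cut f A b (T.dualPt (t + 1)) (-T.v t)) ^ 2 :=
        pow_le_pow_left₀ hgap (by linarith) 2
    _ ≤ 4 * (β * ‖T.w t - -T.v t‖ ^ 2 + ‖b - A (-T.v t)‖ ^ 2) *
          diverg f (T.dualPt t) (T.dualPt (t + 1)) :=
        cut_sub_cut_sq_le h.convexOn h.differentiable h.lipschitz (by linarith)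
    _ ≤ 4 * (β * (2 * R) ^ 2 + (‖b‖ + ‖A‖ * R) ^ 2) *
          diverg f (T.dualPt t) (T.dualPt (t + 1)) := by
        have := diverg_nonneg h.convexOn (h.differentiable (T.dualPt (t + 1)).1) (T.dualPt t)
        gcongr

/-- All the dual points in play satisfy the cuts over `K⁻¹` at the level `h̄⁰ + 1`, so they are
bounded. -/
theorem exists_diverg_le (h : IsBoundedRun f β A b Q K Kinit lam T R) :
    ∃ D : ℝ, ∀ s t : ℕ, ∀ ε ∈ Ioc (0 : ℝ) 1, ∃ y : E₁ × E₂, y.2 ∈ Q ∧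
      diverg f (T.dualPt (s + 1)) y ≤ D ∧
      ∀ x ∈ T.Ktilde t, cut f A b y x ≤ ε - (cost f A b Q (T.xhat t)).toReal := by
  obtain ⟨Q₁, Q₂, hQ, hQ₁, hqualif⟩ := h.qualification
  obtain ⟨M, hM⟩ := exists_norm_snd_le_of_cut_le h.convexOn h.differentiable hQ hQ₁
    h.isCompact_Kinit hqualif ((T.hbar 0).toReal + 1)
  have hanti (t : ℕ) : (T.hbar t).toReal ≤ (T.hbar 0).toReal :=
    h.antitone_toReal_hbar h.convexOn h.differentiable t.zero_le
  have hμ (s : ℕ) : ‖(T.dualPt (s + 1)).2‖ ≤ M := hM _ (h.μ₂_mem _) fun k hk => by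
    have hcut := h.cut_dualPt_succ_le (h.Kinit_subset_KBefore (s + 1) hk)
    linarith [hanti s, mul_nonneg (sub_nonneg.2 h.lam_mem.2.le) (h.gap_nonneg s)]
  refine ⟨β / 2 * (R + R) ^ 2 + (M + M) ^ 2 / 2, fun s t ε hε => ?_⟩
  obtain ⟨y, hy, q, hq, hcut⟩ := h.exists_cut_le t hε.1
  have hqM : ‖q‖ ≤ M := hM (y, q) hq fun k hk => by
    have hgap := h.gap_nonneg t
    rw [Trace.gap] at hgap
    linarith [hcut k (subset_cconv _ (.inl (h.Kinit_subset_KBefore t hk))), hε.2, hanti t]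
  refine ⟨(y, q), hq, (diverg_le h.differentiable h.lipschitz _ _).trans ?_, hcut⟩
  gcongr
  · exact norm_sub_le_of_le (h.norm_w_le _) (h.norm_le_of_mem_Ktilde hy)
  · exact norm_sub_le_of_le hqM (hμ s)

/-- The levels of a phase are all at least `-P(x̂₁^t)`, where `t` is its last iteration, so that the
approximate dual solutions over `K̃^t` are feasible for all the steps of the phase. -/
theorem exists_sum_diverg_le (h : IsBoundedRun f β A b Q K Kinit lam T R) :
    ∃ D : ℝ, ∀ s t : ℕ, s ≤ t → (∀ j ∈ Ioc s t, ¬ T.Prunes f A b Q lam j) →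
      ∑ j ∈ Finset.Ioc s t, diverg f (T.dualPt j) (T.dualPt (j + 1)) ≤ D := by
  obtain ⟨D, hD⟩ := h.exists_diverg_le
  refine ⟨D, fun s t hst hp => sum_diverg_le h.convexOn h.differentiable h.convex_Q hst
    (fun j _ => h.isCompact_Kcut j)
    (fun j _ => h.isProjStep h.convexOn h.differentiable h.exists_cost_ne_top j) fun ε hε => ?_⟩
  obtain ⟨y, hyQ, hyD, hcut⟩ := hD s t ε hε
  refine ⟨y, hyQ, hyD, fun j hj k hk => ?_⟩
  have hpj : ∀ i ∈ Ioc j t, ¬ T.Prunes f A b Q lam i := fun i hi => hp i ⟨hj.1.trans hi.1, hi.2⟩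
  have hk' : k ∈ T.Ktilde t :=
    h.Kcut_subset_Ktilde t (h.Kcut_subset_of_forall_not_prunes hj.2 hpj hk)
  have hgap : (1 - lam) * T.gap f A b Q j ≤ T.gap f A b Q t := by
    refine le_trans ?_ (h.mul_gapRef_le_gap h.lam_mem.2 h.Δ_eq_gap
      (hp t ⟨hj.1.trans_le hj.2, le_rfl⟩))
    rw [h.gapRef_eq_of_forall_not_prunes hj.2 hpj]
    exact mul_le_mul_of_nonneg_left (h.gap_le_gapRef j) (sub_nonneg.2 h.lam_mem.2.le)
  have hhbar : (T.hbar t).toReal ≤ (T.hbar j).toReal :=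
    h.antitone_toReal_hbar h.convexOn h.differentiable hj.2
  have hgap_t : T.gap f A b Q t = (T.hbar t).toReal + (cost f A b Q (T.xhat t)).toReal := rfl
  linarith [hcut k hk']

theorem exists_sub_mul_gapRef_sq_le (h : IsBoundedRun f β A b Q K Kinit lam T R) :
    ∃ B : ℝ, ∀ s t : ℕ, s ≤ t → (∀ j ∈ Ioc s t, ¬ T.Prunes f A b Q lam j) →
      ((t : ℝ) - s) * T.gapRef t ^ 2 ≤ B := by
  obtain ⟨D, hD⟩ := h.exists_sum_diverg_le
  set c := 4 * (β * (2 * R) ^ 2 + (‖b‖ + ‖A‖ * R) ^ 2)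
  have hlam : 0 < 1 - lam := sub_pos.2 h.lam_mem.2
  refine ⟨c * D / (1 - lam) ^ 4, fun s t hst hp => ?_⟩
  have hterm : ∀ j ∈ Finset.Ioc s t, (1 - lam) ^ 4 * T.gapRef t ^ 2 ≤
      c * diverg f (T.dualPt j) (T.dualPt (j + 1)) := fun j hj => by
    rw [Finset.mem_Ioc] at hj
    have hpj : ∀ i ∈ Ioc j t, ¬ T.Prunes f A b Q lam i := fun i hi => hp i ⟨hj.1.trans hi.1, hi.2⟩
    have hv : -T.v j ∈ T.Kcut j := by
      rw [(h.no_prune j (hp j hj)).1]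
      exact .inr rfl
    have hgap : (1 - lam) * T.gapRef t ≤ T.gap f A b Q j := by
      rw [h.gapRef_eq_of_forall_not_prunes hj.2 hpj]
      exact h.mul_gapRef_le_gap h.lam_mem.2 h.Δ_eq_gap (hp j hj)
    have hnonneg := h.gapRef_nonneg t
    calc (1 - lam) ^ 4 * T.gapRef t ^ 2 = ((1 - lam) * ((1 - lam) * T.gapRef t)) ^ 2 := by ring
      _ ≤ ((1 - lam) * T.gap f A b Q j) ^ 2 := by gcongr
      _ ≤ c * diverg f (T.dualPt j) (T.dualPt (j + 1)) := h.sq_mul_gap_le_diverg hv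
  have hsum := Finset.card_nsmul_le_sum _ _ _ fun j hj => hterm j hj
  rw [Nat.card_Ioc, nsmul_eq_mul, Nat.cast_sub hst, ← Finset.mul_sum] at hsum
  have hcD := mul_le_mul_of_nonneg_left (hD s t hst hp) (by positivity : 0 ≤ c)
  rw [le_div_iff₀ (by positivity)]
  linarith

theorem exists_gap_le_div_sqrt (h : IsBoundedRun f β A b Q K Kinit lam T R) :
    ∃ C : ℝ, 0 < C ∧ ∀ t : ℕ, 1 ≤ t → T.gap f A b Q t ≤ C / √t := by
  obtain ⟨B, hB⟩ := h.exists_sub_mul_gapRef_sq_le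
  have hlam : 1 - lam ∈ Ico (0 : ℝ) 1 := ⟨sub_nonneg.2 h.lam_mem.2.le, sub_lt_self 1 h.lam_mem.1⟩
  have hrate := mul_sq_le_of_phases h.gapRef_nonneg h.antitone_gapRef hlam
    (fun t => h.gapRef_succ_le_of_prunes h.lam_mem.2 h.Δ_eq_gap) hB
  set C := (B + T.gapRef 0 ^ 2) / (1 - (1 - lam) ^ 2)
  refine ⟨√(max C 1), by positivity, fun t ht => ?_⟩
  have ht' : (0 : ℝ) < t := Nat.cast_pos.2 ht
  rw [← Real.sqrt_div (by positivity)]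
  refine (h.gap_le_gapRef t).trans (Real.le_sqrt_of_sq_le ?_)
  rw [le_div_iff₀' ht']
  exact (hrate t).trans (le_max_left C 1)

end IsBoundedRun

end Rate

end DLS

end

theorem mainTheorem4_general
    {E₁ E₂ : Type*}
    [NormedAddCommGroup E₁] [InnerProductSpace ℝ E₁] [CompleteSpace E₁]
    [MeasurableSpace E₁] [BorelSpace E₁]
    [NormedAddCommGroup E₂] [InnerProductSpace ℝ E₂] [CompleteSpace E₂]
    (f : E₁ → ℝ) (β : ℝ≥0) (hf_convex : ConvexOn ℝ Set.univ f)
    (hf_diff : Differentiable ℝ f) (hf_lip : LipschitzWith β (gradient f))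
    (Q Q₁ Q₂ : Set E₂) (hQ : Q ⊆ Q₁ + Q₂) (hQ_convex : Convex ℝ Q)
    (hQ₁_bdd : Bornology.IsBounded Q₁)
    (K : Set E₁) (hK_closed : IsClosed K) (hK_convex : Convex ℝ K)
    (A : E₁ →L[ℝ] E₂) (b : E₂)
    (Kinit : Set E₁) (hKinit_compact : IsCompact Kinit) (hKinit_sub : Kinit ⊆ K)
    (hqualif : -b ∈ interior (DLS.polar Q₂ - A '' DLS.cconv Kinit))
    (lam : ℝ) (hlam : lam ∈ Set.Ioo (0 : ℝ) 1)
    (T : DLS.Trace E₁ E₂) (hT : DLS.IsRun f A b Q K Kinit lam T)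
    (horacle : ∃ C : ℝ, ∀ t, ‖T.v t‖ ≤ C) :
    (∀ t, T.Δ f A b Q t =
      (DLS.cost f A b Q (T.xhat t) + DLS.indic K (T.xhat t)) + DLS.dualCost f A b Q K (T.μhat t)) ∧
    (∀ (t : ℕ) (x : WithLp 2 (E₁ × E₂)),
      (DLS.IsSolution (DLS.liftedCost f b Q) (-T.Etilde A t) x ∧ x.fst = T.xhat t) ↔
        (x.fst = T.xhat t ∧ x.snd = A (T.xhat t))) ∧
    ∃ C : ℝ, 0 < C ∧ ∀ t : ℕ, 1 ≤ t →
      (0 ≤ T.Δ f A b Q t ∧ T.Δ f A b Q t ≤ ((C / Real.sqrt t : ℝ) : EReal)) ∧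
      (0 ≤ DLS.cost f A b Q (T.xhat t) - DLS.value f A b Q K ∧
        DLS.cost f A b Q (T.xhat t) - DLS.value f A b Q K ≤ ((C / Real.sqrt t : ℝ) : EReal)) ∧
      (0 ≤ DLS.dualCost f A b Q K (T.μhat t) + DLS.value f A b Q K ∧
        DLS.dualCost f A b Q K (T.μhat t) + DLS.value f A b Q K
          ≤ ((C / Real.sqrt t : ℝ) : EReal)) := by
  obtain ⟨R₁, hR₁⟩ := hKinit_compact.isBounded.exists_norm_le
  obtain ⟨R₂, hR₂⟩ := horacle
  have h : DLS.IsBoundedRun f β A b Q K Kinit lam T (max R₁ (max R₂ ‖T.w 0‖)) :=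
    { hT with
      convexOn := hf_convex
      differentiable := hf_diff
      lipschitz := hf_lip
      convex_Q := hQ_convex
      isClosed_K := hK_closed
      convex_K := hK_convex
      isCompact_Kinit := hKinit_compact
      Kinit_subset := hKinit_sub
      qualification := ⟨Q₁, Q₂, hQ, hQ₁_bdd, hqualif⟩
      lam_mem := hlam
      norm_le_of_mem_Kinit := fun x hx => le_max_of_le_left (hR₁ x hx)
      norm_v_le := fun t => le_max_of_le_right (le_max_of_le_left (hR₂ t))
      norm_w_zero_le := le_max_of_le_right (le_max_right _ _) }
  obtain ⟨C, hC, hrate⟩ := h.exists_gap_le_div_sqrt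
  exact ⟨h.Δ_eq_cost_add_dualCost, hT.isSolution_liftedCost_iff, C, hC,
    fun t ht => h.suboptimality_bounds (hrate t ht)⟩

theorem mainTheorem4
    {E₁ E₂ : Type*}
    [NormedAddCommGroup E₁] [InnerProductSpace ℝ E₁] [CompleteSpace E₁]
    [MeasurableSpace E₁] [BorelSpace E₁]
    [NormedAddCommGroup E₂] [InnerProductSpace ℝ E₂] [CompleteSpace E₂]
    -- `f` is convex with `β`-Lipschitz gradient
    (f : E₁ → ℝ) (β : ℝ≥0) (hβ : 0 < β) (hf_convex : ConvexOn ℝ Set.univ f)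
    (hf_diff : Differentiable ℝ f) (hf_lip : LipschitzWith β (gradient f))
    -- `Q` is the sum of a bounded closed convex set and a closed convex cone
    (Q Q₁ Q₂ : Set E₂) (hQ : Q = Q₁ + Q₂) (hQ_ne : Q.Nonempty)
    (hQ₁_closed : IsClosed Q₁) (hQ₁_convex : Convex ℝ Q₁) (hQ₁_bdd : Bornology.IsBounded Q₁)
    (hQ₂_closed : IsClosed Q₂) (hQ₂_convex : Convex ℝ Q₂)
    (hQ₂_cone : ∀ c : ℝ, 0 < c → ∀ x ∈ Q₂, c • x ∈ Q₂)
    (K : Set E₁) (hK_ne : K.Nonempty) (hK_closed : IsClosed K) (hK_convex : Convex ℝ K)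
    (A : E₁ →L[ℝ] E₂) (b : E₂)
    -- qualification condition
    (Kinit : Set E₁) (hKinit_compact : IsCompact Kinit) (hKinit_sub : Kinit ⊆ K)
    (hqualif : -b ∈ interior (DLS.polar Q₂ - A '' DLS.cconv Kinit))
    -- an execution of the algorithm with bounded oracle outputs
    (lam : ℝ) (hlam : lam ∈ Set.Ioo (0 : ℝ) 1)
    (T : DLS.Trace E₁ E₂) (hT : DLS.IsRun f A b Q K Kinit lam T)
    (horacle : ∃ C : ℝ, ∀ t, ‖T.v t‖ ≤ C) :
    -- `Δ^t` is the primal-dual gap at `(x̂^t, μ̂^t)`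
    (∀ t, T.Δ f A b Q t =
      (DLS.cost f A b Q (T.xhat t) + DLS.indic K (T.xhat t)) + DLS.dualCost f A b Q K (T.μhat t)) ∧
    -- the solution `x̂^t` of the lifted primal update with first component `x̂₁^t` exists and
    -- satisfies `x̂₂^t = A x̂₁^t`
    (∀ (t : ℕ) (x : WithLp 2 (E₁ × E₂)),
      (DLS.IsSolution (DLS.liftedCost f b Q) (-T.Etilde A t) x ∧ x.fst = T.xhat t) ↔
        (x.fst = T.xhat t ∧ x.snd = A (T.xhat t))) ∧
    -- convergence rates
    ∃ C : ℝ, 0 < C ∧ ∀ t : ℕ, 1 ≤ t →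
      (0 ≤ T.Δ f A b Q t ∧ T.Δ f A b Q t ≤ ((C / Real.sqrt t : ℝ) : EReal)) ∧
      (0 ≤ DLS.cost f A b Q (T.xhat t) - DLS.value f A b Q K ∧
        DLS.cost f A b Q (T.xhat t) - DLS.value f A b Q K ≤ ((C / Real.sqrt t : ℝ) : EReal)) ∧
      (0 ≤ DLS.dualCost f A b Q K (T.μhat t) + DLS.value f A b Q K ∧
        DLS.dualCost f A b Q K (T.μhat t) + DLS.value f A b Q K
          ≤ ((C / Real.sqrt t : ℝ) : EReal)) := by
  exact mainTheorem4_general f β hf_convex hf_diff hf_lip Q Q₁ Q₂ hQ.subset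
    (hQ ▸ hQ₁_convex.add hQ₂_convex) hQ₁_bdd K hK_closed hK_convex A b Kinit hKinit_compact
    hKinit_sub hqualif lam hlam T hT horacle
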